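/- Fix the proposition symbols $\Phi=\{p_0,p_1,p_2,\dots\}$. Formulae of extended modal inclusion logic $\mathsf{EMinc}$ are generated by $$\varphi ::= p\mid\neg p\mid(\varphi\wedge\varphi)\mid(\varphi\vee\varphi)\mid\Diamond\varphi\mid\Box\varphi\mid \varphi_1,\dots,\varphi_n\subseteq\psi_1,\dots,\psi_n ,$$ where $p\in\Phi$, $n\in\mathbb N$ and $\varphi_1,\dots,\varphi_n,\psi_1,\dots,\psi_n$ are formulae of modal logic $\mathsf{ML}$, i.e. formulae without inclusion atoms. Modal inclusion logic $\mathsf{Minc}$ is the fragment in which all these parameters are proposition symbols. Let $K=(W,R,V)$ be a Kripke model with $W\neq\emptyset$, $R\subseteq W\times W$ and $V:\Phi\to\mathcal P(W)$, and let $T\subseteq W$ (a team). Write $R[T]=\{w\mid\exists v\in T:\ vRw\}$. Lax team semantics is given by - $K,T\models p$ iff $T\subseteq V(p)$; $K,T\models\neg p$ iff $T\cap V(p)=\emptyset$; - $K,T\models\varphi\wedge\psi$ iff $K,T\models\varphi$ and $K,T\models\psi$; - $K,T\models\varphi\vee\psi$ iff $K,T_1\models\varphi$ and $K,T_2\models\psi$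 for some $T_1,T_2$ with $T_1\cup T_2=T$; - $K,T\models\Diamond\varphi$ iff $K,S\models\varphi$ for some $S\subseteq R[T]$ such that every $w\in T$ has an $R$-successor in $S$; - $K,T\models\Box\varphi$ iff $K,R[T]\models\varphi$; - $K,T\models\varphi_1,\dots,\varphi_n\subseteq\psi_1,\dots,\psi_n$ iff for every $w\in T$ there is $v\in T$ such that, for all $1\le i\le n$, $K,\{w\}\models\varphi_i$ if and only if $K,\{v\}\models\psi_i$. Strict team semantics differs in two clauses: in the clause for $\vee$ one also requires $T_1\cap T_2=\emptyset$, and in the clause for $\Diamond$ one requires $S=f(T)$ for some $f:T\to W$ with $wRf(w)$ for all $w\in T$. A formula is valid (under lax or under strict semantics) if it is satisfied by every team of every Kripke model. $\mathrm{VAL}(\mathsf{Minc})$ and $\mathrm{VAL}(\mathsf{EMinc})$ are the problems of deciding, given a formula of the respective logic (written in prefix notation over $\{0,1\}$ with binary indices of proposition symbols), whether it is valid; they are regarded as languages over $\{0,1\}$. Reductions are polynomial-time many-one reductions, and completeness is meant with respect to them. **Theorem.** Let $\mathcal C$ be a complexity class (a set of languages over $\{0,1\}$) that is closed under polynomial-time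 reductions: if $A$ reduces to $B$ and $B\in\mathcal C$, then $A\in\mathcal C$. Then under lax semantics $\mathrm{VAL}(\mathsf{Minc})$ is complete for $\mathcal C$ if and only if $\mathrm{VAL}(\mathsf{EMinc})$ is complete for $\mathcal C$; and likewise, under strict semantics $\mathrm{VAL}(\mathsf{Minc})$ is complete for $\mathcal C$ if and only if $\mathrm{VAL}(\mathsf{EMinc})$ is complete for $\mathcal C$. -/

import Mathlib

universe u

/-- Formulae of modal logic `ML(Φ)`, in negation normal form. -/
inductive ML (Φ : Type) : Type
  | prop : Φ → ML Φ
  | nprop : Φ → ML Φ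
  | and : ML Φ → ML Φ → ML Φ
  | or : ML Φ → ML Φ → ML Φ
  | dia : ML Φ → ML Φ
  | box : ML Φ → ML Φ

/-- Formulae of extended modal inclusion logic `EMinc(Φ)`. The inclusion atom
`φ₁,…,φₙ ⊆ ψ₁,…,ψₙ` is `inc [(φ₁,ψ₁),…,(φₙ,ψₙ)]`. -/
inductive EMinc (Φ : Type) : Type
  | prop : Φ → EMinc Φ
  | nprop : Φ → EMinc Φ
  | and : EMinc Φ → EMinc Φ → EMinc Φ
  | or : EMinc Φ → EMinc Φ → EMinc Φ
  | dia : EMinc Φ → EMinc Φ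
  | box : EMinc Φ → EMinc Φ
  | inc : List (ML Φ × ML Φ) → EMinc Φ

/-- `φ` is a formula of modal inclusion logic `Minc(Φ)`: all parameters of its inclusion atoms are
proposition symbols. -/
def EMinc.IsMinc {Φ : Type} : EMinc Φ → Prop
  | .prop _ => True
  | .nprop _ => True
  | .and φ ψ => φ.IsMinc ∧ ψ.IsMinc
  | .or φ ψ => φ.IsMinc ∧ ψ.IsMinc
  | .dia φ => φ.IsMinc
  | .box φ => φ.IsMinc
  | .inc ps => ∀ c ∈ ps, (∃ p, c.1 = ML.prop p) ∧ (∃ q, c.2 = ML.prop q)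

/-- A Kripke `Φ`-model `(W, R, V)` with a non-empty domain `W`. -/
structure KripkeModel (Φ : Type) where
  W : Type u
  nonempty : Nonempty W
  R : W → W → Prop
  V : Φ → Set W

/-- The two kinds of team semantics. -/
inductive TeamSemantics : Type
  | lax
  | strict

/-- `R[T]`. -/
def KripkeModel.image {Φ : Type} (K : KripkeModel.{u} Φ) (T : Set K.W) : Set K.W :=
  {w | ∃ v ∈ T, K.R v w}

/-- `R⁻¹[T]`. -/
def KripkeModel.preimage {Φ : Type} (K : KripkeModel.{u} Φ) (T : Set K.W) : Set K.W :=
  {w | ∃ v ∈ T, K.R w v}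

/-- The ways of splitting the team `T` that disjunction may use. -/
def TeamSemantics.Split {α : Type u} : TeamSemantics → Set α → Set α → Set α → Prop
  | .lax, T, T₁, T₂ => T₁ ∪ T₂ = T
  | .strict, T, T₁, T₂ => T₁ ∪ T₂ = T ∧ T₁ ∩ T₂ = ∅

/-- The successor teams `S` of `T` that `◇` may use: `T[R]S` in lax semantics, and `S = f(T)` for
a function `f : T → W` choosing successors in strict semantics. -/
def TeamSemantics.Successor {Φ : Type} (K : KripkeModel.{u} Φ) :
    TeamSemantics → Set K.W → Set K.W → Prop
  | .lax, T, S => S ⊆ K.image T ∧ T ⊆ K.preimage S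
  | .strict, T, S => ∃ f : T → K.W, (∀ w : T, K.R w (f w)) ∧ S = Set.range f

/-- Team semantics of `ML`. -/
def ML.Sat {Φ : Type} (s : TeamSemantics) (K : KripkeModel.{u} Φ) : Set K.W → ML Φ → Prop
  | T, .prop p => ∀ w ∈ T, w ∈ K.V p
  | T, .nprop p => ∀ w ∈ T, w ∉ K.V p
  | T, .and φ ψ => ML.Sat s K T φ ∧ ML.Sat s K T ψ
  | T, .or φ ψ => ∃ T₁ T₂ : Set K.W, s.Split T T₁ T₂ ∧ ML.Sat s K T₁ φ ∧ ML.Sat s K T₂ ψ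
  | T, .dia φ => ∃ S : Set K.W, TeamSemantics.Successor K s T S ∧ ML.Sat s K S φ
  | T, .box φ => ML.Sat s K (K.image T) φ

/-- Team semantics of `EMinc`. -/
def EMinc.Sat {Φ : Type} (s : TeamSemantics) (K : KripkeModel.{u} Φ) : Set K.W → EMinc Φ → Prop
  | T, .prop p => ∀ w ∈ T, w ∈ K.V p
  | T, .nprop p => ∀ w ∈ T, w ∉ K.V p
  | T, .and φ ψ => EMinc.Sat s K T φ ∧ EMinc.Sat s K T ψ
  | T, .or φ ψ => ∃ T₁ T₂ : Set K.W, s.Split T T₁ T₂ ∧ EMinc.Sat s K T₁ φ ∧ EMinc.Sat s K T₂ ψ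
  | T, .dia φ => ∃ S : Set K.W, TeamSemantics.Successor K s T S ∧ EMinc.Sat s K S φ
  | T, .box φ => EMinc.Sat s K (K.image T) φ
  | T, .inc ps => ∀ w ∈ T, ∃ v ∈ T, ∀ c ∈ ps, (ML.Sat s K {w} c.1 ↔ ML.Sat s K {v} c.2)

/-- `φ` holds in every team of every Kripke `Φ`-model. -/
def EMinc.Valid {Φ : Type} (s : TeamSemantics) (φ : EMinc Φ) : Prop :=
  ∀ (K : KripkeModel.{u} Φ) (T : Set K.W), EMinc.Sat s K T φ

/-- Self-delimiting binary code of the index of a proposition symbol: every binary digit is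
preceded by `1`, and the end is marked by `0`. -/
def encodeIndex (n : ℕ) : List Bool :=
  (Computability.encodeNat n).flatMap (fun b => [true, b]) ++ [false]

/-- Binary code of an `ML`-formula: prefix notation, with a block of three bits per connective. -/
def ML.encode : ML ℕ → List Bool
  | .prop p => [false, false, false] ++ encodeIndex p
  | .nprop p => [false, false, true] ++ encodeIndex p
  | .and φ ψ => [false, true, false] ++ φ.encode ++ ψ.encode
  | .or φ ψ => [false, true, true] ++ φ.encode ++ ψ.encode
  | .dia φ => [true, false, false] ++ φ.encode
  | .box φ => [true, false, true] ++ φ.encode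

/-- Binary code of an `EMinc`-formula: as for `ML`; in an inclusion atom each pair of parameters
is preceded by `1`, and the end is marked by `0`. -/
def EMinc.encode : EMinc ℕ → List Bool
  | .prop p => [false, false, false] ++ encodeIndex p
  | .nprop p => [false, false, true] ++ encodeIndex p
  | .and φ ψ => [false, true, false] ++ φ.encode ++ ψ.encode
  | .or φ ψ => [false, true, true] ++ φ.encode ++ ψ.encode
  | .dia φ => [true, false, false] ++ φ.encode
  | .box φ => [true, false, true] ++ φ.encode
  | .inc ps => [true, true, false] ++
      ps.flatMap (fun c => [true] ++ c.1.encode ++ c.2.encode) ++ [false]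

/-- The decision problem `VAL(EMinc)`, over the proposition symbols `p₀, p₁, p₂, …`. -/
def valEMinc (s : TeamSemantics) : Language Bool :=
  {x | ∃ φ : EMinc ℕ, EMinc.Valid.{u} s φ ∧ φ.encode = x}

/-- The decision problem `VAL(Minc)`, over the proposition symbols `p₀, p₁, p₂, …`. -/
def valMinc (s : TeamSemantics) : Language Bool :=
  {x | ∃ φ : EMinc ℕ, φ.IsMinc ∧ EMinc.Valid.{u} s φ ∧ φ.encode = x}

/-- Polynomial-time many-one reducibility. -/
def PolyTimeReducible (A B : Language Bool) : Prop :=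
  ∃ f : List Bool → List Bool,
    Nonempty (Turing.TM2ComputableInPolyTime (id : List Bool → List Bool)
      (id : List Bool → List Bool) f) ∧
    ∀ x, x ∈ A ↔ f x ∈ B

/-- The class `C` of languages is closed under polynomial-time reductions. -/
def ClosedUnderPolyTimeReductions (C : Set (Language Bool)) : Prop :=
  ∀ A B : Language Bool, PolyTimeReducible A B → B ∈ C → A ∈ C

/-- `A` is complete for `C` with respect to polynomial-time reductions. -/
def IsCompleteFor (A : Language Bool) (C : Set (Language Bool)) : Prop :=
  A ∈ C ∧ ∀ B ∈ C, PolyTimeReducible B A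

/-! Both problems reduce to each other, and closure of the class under reductions then transfers
membership one way and hardness the other.

From `Minc` to `EMinc` it suffices to recognize codes of `Minc` formulae and to send every other
word to the empty word, which codes nothing (`restrict`, `mem_valMinc_iff`).

From `EMinc` to `Minc`, every parameter χ of an inclusion atom is replaced by a fresh proposition
symbol naming it. Names may be interpreted wrongly, so the flattened formula is put in disjunction
with an `ML` formula, `EMinc.corrupt`, which says of a world that a wrongly named world can be
reached at the modal depth of some inclusion atom. `ML` is flat (`ML.sat_iff`), so any team may be
split into its corrupt worlds and the others, and on the others the flattened formula agrees with φ
(`EMinc.sat_flatten_iff`). Hence validity of φ gives validity of the translation. Conversely, a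
model of the old symbols is expanded by the correct interpretation of the names; no world is then
corrupt, the first half of the split is empty, and the flattened formula, hence φ, holds in the
whole team (`EMinc.valid_toMinc_iff`). The split into a set and its complement is disjoint, so the
argument covers lax and strict semantics at once.

For the running time, the name of χ is a number whose binary digits contain the code of χ itself, so
equal parameters get equal names without any table. A pushdown automaton labels each bit of the
input by its syntactic role, and the translation is a right-to-left pass over the labelled bits
(`PSym.translate_encode`). These passes are written as structured stack programs with a cost
semantics, and a program is appended to a given polynomial-time machine
(`Turing.FinTM2.computableInPolyTime_comp`). Composition with these two programs is all the
transitivity that is needed. -/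

/-! ### Structured stack programs and their compilation to labelled code -/

/-- Programs working on a family of stacks, the stack `k` having the alphabet `Γ k`. `case` pops a
symbol and branches on it; `loop` pops symbols from a stack until it is empty. -/
inductive Prog {K : Type} (Γ : K → Type) : Type
  | skip : Prog Γ
  | push (k : K) (a : Γ k) : Prog Γ
  | seq : Prog Γ → Prog Γ → Prog Γ
  | case (k : K) (P : Option (Γ k) → Prog Γ) : Prog Γ
  | loop (k : K) (P : Γ k → Prog Γ) : Prog Γ

namespace Prog

open Function

variable {K : Type} {Γ : K → Type}

/-- The contents of all stacks. -/
abbrev Store (Γ : K → Type) := ∀ k, List (Γ k)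

/-- `Exec P s s' n`: the program `P` run in `s` terminates in `s'` within `n` elementary steps. -/
inductive Exec [DecidableEq K] : Prog Γ → Store Γ → Store Γ → ℕ → Prop
  | skip (s n) : Exec .skip s s n
  | push (s k a n) : Exec (.push k a) s (update s k (a :: s k)) (n + 1)
  | seq {P Q s s' s'' m n t} : Exec P s s' m → Exec Q s' s'' n → m + n ≤ t →
      Exec (.seq P Q) s s'' t
  | case {k P s s' n t} : Exec (P (s k).head?) (update s k (s k).tail) s' n → n + 1 ≤ t →
      Exec (.case k P) s s' t
  | loop_nil {k P s} (n) : s k = [] → Exec (.loop k P) s s (n + 1)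
  | loop_cons {k P s s' s'' a l m n t} : s k = a :: l → Exec (P a) (update s k l) s' m →
      Exec (.loop k P) s' s'' n → m + n + 1 ≤ t → Exec (.loop k P) s s'' t

/-- Elementary instructions with continuations in `X`. -/
inductive Instr (Γ : K → Type) (X : Type) : Type
  | push (k : K) (a : Γ k) (next : X) : Instr Γ X
  | pop (k : K) (next : Option (Γ k) → X) : Instr Γ X

/-- Relabelling of continuations. -/
def Instr.map {X Y : Type} (f : X → Y) : Instr Γ X → Instr Γ Y
  | .push k a x => .push k a (f x)
  | .pop k x => .pop k (fun o => f (x o))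

/-- The effect of an instruction. -/
def Instr.run [DecidableEq K] {X : Type} : Instr Γ X → Store Γ → X × Store Γ
  | .push k a x, s => (x, update s k (a :: s k))
  | .pop k x, s => (x (s k).head?, update s k (s k).tail)

theorem Instr.run_map [DecidableEq K] {X Y : Type} (f : X → Y) (i : Instr Γ X) (s : Store Γ) :
    (i.map f).run s = (f (i.run s).1, (i.run s).2) := by
  cases i <;> rfl

/-- Unstructured code: finitely many labels, each with an instruction; the label `none` is the
exit. -/
structure Code (Γ : K → Type) where
  Λ : Type
  fin : Fintype Λ
  start : Option Λ
  instr : Λ → Instr Γ (Option Λ)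

attribute [instance] Code.fin

/-- `Reach i c c' n`: the configuration `c'` is reached from `c` within `n` steps. -/
inductive Reach [DecidableEq K] {Λ : Type} (i : Λ → Instr Γ (Option Λ)) :
    Option Λ × Store Γ → Option Λ × Store Γ → ℕ → Prop
  | refl (c n) : Reach i c c n
  | step {l s c n} : Reach i ((i l).run s) c n → Reach i (some l, s) c (n + 1)

theorem Reach.mono [DecidableEq K] {Λ : Type} {i : Λ → Instr Γ (Option Λ)}
    {c c' : Option Λ × Store Γ} {n : ℕ} (h : Reach i c c' n) :
    ∀ {m : ℕ}, n ≤ m → Reach i c c' m := by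
  induction h with
  | refl c n => exact fun _ => .refl _ _
  | @step l s c n _ ih =>
    intro m hm
    obtain ⟨m, rfl⟩ : ∃ m', m = m' + 1 := ⟨m - 1, by omega⟩
    exact .step (ih (by omega))

theorem Reach.trans [DecidableEq K] {Λ : Type} {i : Λ → Instr Γ (Option Λ)}
    {c c' c'' : Option Λ × Store Γ} {m n : ℕ} (h : Reach i c c' m) (h' : Reach i c' c'' n) :
    Reach i c c'' (m + n) := by
  induction h with
  | refl c m => exact h'.mono (by omega)
  | step _ ih => rw [Nat.add_right_comm]; exact .step (ih h')

/-- Nothing is asked of `f none`, so the exit of a component may be redirected to any label of the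
compound code. -/
theorem Reach.map [DecidableEq K] {Λ Λ' : Type} {i : Λ → Instr Γ (Option Λ)}
    {i' : Λ' → Instr Γ (Option Λ')} (f : Option Λ → Option Λ')
    (hf : ∀ l, ∃ l', f (some l) = some l' ∧ i' l' = (i l).map f)
    {c c' : Option Λ × Store Γ} {n : ℕ} (h : Reach i c c' n) :
    Reach i' (f c.1, c.2) (f c'.1, c'.2) n := by
  induction h with
  | refl c n => exact Reach.refl _ _
  | @step l s c n _ ih =>
    obtain ⟨l', h1, h2⟩ := hf l
    simp only [h1]
    refine .step ?_
    rw [h2, Instr.run_map]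
    exact ih

/-- Labels of a component of a compound program, whose exit is redirected to `x`. -/
def embed {Λ Λ' : Type} (e : Λ → Λ') (x : Option Λ') (o : Option Λ) : Option Λ' :=
  o.elim x (fun l => some (e l))

/-- Sequential composition. -/
def Code.seq (C D : Code Γ) : Code Γ where
  Λ := C.Λ ⊕ D.Λ
  fin := inferInstance
  start := embed Sum.inl (embed Sum.inr none D.start) C.start
  instr := Sum.elim (fun l => (C.instr l).map (embed Sum.inl (embed Sum.inr none D.start)))
    (fun l => (D.instr l).map (embed Sum.inr none))

/-- Popping a symbol and branching. -/
def Code.case (k : K) [Fintype (Γ k)] (C : Option (Γ k) → Code Γ) : Code Γ where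
  Λ := Option (Σ o, (C o).Λ)
  fin := inferInstance
  start := some none
  instr
    | none => .pop k (fun o => embed (fun l => some ⟨o, l⟩) none (C o).start)
    | some ⟨o, l⟩ => ((C o).instr l).map (embed (fun l => some ⟨o, l⟩) none)

/-- Iteration until a stack is empty. -/
def Code.loop (k : K) [Fintype (Γ k)] (C : Γ k → Code Γ) : Code Γ where
  Λ := Option (Σ a, (C a).Λ)
  fin := inferInstance
  start := some none
  instr
    | none => .pop k (fun o => match o with
      | none => none
      | some a => embed (fun l => some ⟨a, l⟩) (some none) (C a).start)
    | some ⟨a, l⟩ => ((C a).instr l).map (embed (fun l => some ⟨a, l⟩) (some none))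

/-- Compilation of programs. -/
def code [∀ k, Fintype (Γ k)] : Prog Γ → Code Γ
  | .skip => ⟨Empty, inferInstance, none, Empty.elim⟩
  | .push k a => ⟨Unit, inferInstance, some (), fun _ => .push k a none⟩
  | .seq P Q => P.code.seq Q.code
  | .case k P => Code.case k (fun o => (P o).code)
  | .loop k P => Code.loop k (fun a => (P a).code)

/-- Each component sits inside the compound code by `embed`, its exit redirected to where control
goes on: to the second program, to the exit, or back to the head of the loop. `Reach.map` transports
the runs of the components. The bound is kept, since only pushes and pops cost a step in `Exec` and
each is one instruction. -/
theorem Exec.reach [DecidableEq K] [∀ k, Fintype (Γ k)] {P : Prog Γ} {s s' : Store Γ} {n : ℕ}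
    (h : Exec P s s' n) : Reach P.code.instr (P.code.start, s) (none, s') n := by
  induction h with
  | skip s n => exact Reach.refl _ _
  | push s k a n => exact Reach.step (i := (Prog.push k a).code.instr) (.refl _ _)
  | @seq P Q s s' s'' m n t _ _ ht ih1 ih2 =>
    refine (Reach.trans (i := (Prog.seq P Q).code.instr)
      (ih1.map (embed Sum.inl (embed Sum.inr none Q.code.start)) fun l => ⟨_, rfl, rfl⟩)
      (ih2.map (embed Sum.inr none) fun l => ⟨_, rfl, rfl⟩)).mono ht
  | @case k P s s' n t _ ht ih =>
    refine Reach.mono (Reach.step (i := (Prog.case k P).code.instr) ?_) ht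
    exact ih.map (i' := (Prog.case k P).code.instr)
      (embed (fun l => some ⟨(s k).head?, l⟩) none) fun l => ⟨_, rfl, rfl⟩
  | @loop_nil k P s n hk =>
    refine Reach.step (i := (Prog.loop k P).code.instr) ?_
    have : ((Prog.loop k P).code.instr none).run s = (none, s) := by
      simp [code, Code.loop, Instr.run, hk]
    rw [this]
    exact Reach.refl _ _
  | @loop_cons k P s s' s'' a l m n t hk _ _ ht ih1 ih2 =>
    refine Reach.mono (Reach.step (i := (Prog.loop k P).code.instr) ?_) ht
    have : ((Prog.loop k P).code.instr none).run s =
        (embed (fun l => some ⟨a, l⟩) (some none) (P a).code.start, update s k l) := by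
      simp [code, Code.loop, Instr.run, hk]
    rw [this]
    exact Reach.trans (ih1.map (i' := (Prog.loop k P).code.instr)
      (embed (fun l => some ⟨a, l⟩) (some none)) fun l => ⟨_, rfl, rfl⟩) ih2

end Prog

/-! ### Running a stack program after a Turing machine -/

namespace Turing.FinTM2

open Function TM2

/-- `tm.ReachIn n c c'`: the configuration `c'` is reached from `c` in exactly `n` steps. -/
def ReachIn (tm : FinTM2) (n : ℕ) (c c' : tm.Cfg) : Prop :=
  (flip bind tm.step)^[n] (some c) = some c'

theorem ReachIn.trans {tm : FinTM2} {m n : ℕ} {c c' c'' : tm.Cfg} (h : tm.ReachIn m c c')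
    (h' : tm.ReachIn n c' c'') : tm.ReachIn (m + n) c c'' := by
  unfold ReachIn at *
  rw [Nat.add_comm, iterate_add_apply, h, h']

theorem reachIn_one {tm : FinTM2} {c c' : tm.Cfg} (h : tm.step c = some c') :
    tm.ReachIn 1 c c' := h

theorem ReachIn.succ_inv {tm : FinTM2} {n : ℕ} {c c' : tm.Cfg} (h : tm.ReachIn (n + 1) c c') :
    ∃ d, tm.step c = some d ∧ tm.ReachIn n d c' := by
  unfold ReachIn at *
  rw [iterate_succ_apply] at h
  change (flip bind tm.step)^[n] (tm.step c) = some c' at h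
  cases hd : tm.step c with
  | none =>
    exfalso
    rw [hd] at h
    have : ∀ m, (flip bind tm.step)^[m] none = none := by
      intro m
      induction m with
      | zero => rfl
      | succ m ih => rw [iterate_succ_apply]; exact ih
    rw [this] at h
    cases h
  | some d => exact ⟨d, rfl, by rw [hd] at h; exact h⟩

/-- An upper bound for the number of symbols a statement pushes. -/
def pushCount {K : Type} {Γ : K → Type} {Λ σ : Type} : TM2.Stmt Γ Λ σ → ℕ
  | .push _ _ q => pushCount q + 1
  | .peek _ _ q => pushCount q
  | .pop _ _ q => pushCount q
  | .load _ q => pushCount q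
  | .branch _ q₁ q₂ => pushCount q₁ + pushCount q₂
  | .goto _ => 0
  | .halt => 0

theorem length_stepAux_le {K : Type} [DecidableEq K] {Γ : K → Type} {Λ σ : Type}
    (q : TM2.Stmt Γ Λ σ) (v : σ) (S : ∀ k, List (Γ k)) (k : K) :
    ((stepAux q v S).stk k).length ≤ (S k).length + pushCount q := by
  induction q generalizing v S with
  | push k' f q ih =>
    refine (ih _ _).trans ?_
    by_cases h : k = k'
    · subst h; simp [pushCount]; omega
    · simp [h, pushCount]
  | peek k' f q ih => exact ih _ _
  | pop k' f q ih =>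
    refine (ih _ _).trans ?_
    by_cases h : k = k'
    · subst h; simp [pushCount]
    · simp [h, pushCount]
  | load f q ih => exact ih _ _
  | branch f q₁ q₂ ih₁ ih₂ =>
    simp only [stepAux, pushCount]
    cases f v
    · exact (ih₂ _ _).trans (by omega)
    · exact (ih₁ _ _).trans (by omega)
  | goto f => simp [pushCount]
  | halt => simp [pushCount]

/-- Each step executes one statement, which pushes at most `B` symbols. The program appended to a
machine is timed by the length of the machine's output, so that length has to be bounded
polynomially. -/
theorem ReachIn.length_le {tm : FinTM2} {B : ℕ} (hB : ∀ l, pushCount (tm.m l) ≤ B) (k : tm.K)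
    {n : ℕ} {c c' : tm.Cfg} (h : tm.ReachIn n c c') :
    (c'.stk k).length ≤ (c.stk k).length + B * n := by
  induction n generalizing c with
  | zero =>
    cases h
    simp
  | succ n ih =>
    obtain ⟨d, h1, h2⟩ := h.succ_inv
    refine (ih h2).trans ?_
    obtain ⟨l, v, S⟩ := c
    cases l with
    | none => cases h1
    | some l =>
      cases h1
      have := length_stepAux_le (tm.m l) v S k
      have := hB l
      simp only [Nat.mul_succ]
      omega

section Comp

variable {K : Type} {Γ : K → Type}

/-- The stack alphabets of two machines put together. -/
@[reducible] def sumΓ {K₁ : Type} (Γ₁ : K₁ → Type) (Γ : K → Type) : K₁ ⊕ K → Type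
  | .inl k => Γ₁ k
  | .inr k => Γ k

/-- The stacks of two machines put together. -/
def join {K₁ : Type} {Γ₁ : K₁ → Type} (S : ∀ k, List (Γ₁ k)) (s : ∀ k, List (Γ k)) :
    ∀ k : K₁ ⊕ K, List (sumΓ Γ₁ Γ k)
  | .inl k => S k
  | .inr k => s k

theorem update_join_inl {K₁ : Type} {Γ₁ : K₁ → Type} [DecidableEq K₁] [DecidableEq K]
    (S : ∀ k, List (Γ₁ k)) (s : ∀ k, List (Γ k)) (k : K₁) (l : List (Γ₁ k)) :
    update (join S s) (.inl k) l = join (update S k l) s := by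
  funext k'
  rcases k' with k' | k'
  · by_cases h : k' = k
    · subst h; simp [join]
    · rw [update_of_ne (by simpa using h)]; simp [join, h]
  · rw [update_of_ne (by simp)]; rfl

theorem update_join_inr {K₁ : Type} {Γ₁ : K₁ → Type} [DecidableEq K₁] [DecidableEq K]
    (S : ∀ k, List (Γ₁ k)) (s : ∀ k, List (Γ k)) (k : K) (l : List (Γ k)) :
    update (join S s) (.inr k) l = join S (update s k l) := by
  funext k'
  rcases k' with k' | k'
  · rw [update_of_ne (by simp)]; rfl
  · by_cases h : k' = k
    · subst h; simp [join]
    · rw [update_of_ne (by simpa using h)]; simp [join, h]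

/-- The symbol of the stack `k` kept in a register. -/
def readReg [DecidableEq K] (k : K) : Option (Σ k, Γ k) → Option (Γ k)
  | some ⟨k', a⟩ => if h : k' = k then some (h ▸ a) else none
  | none => none

theorem readReg_map [DecidableEq K] (k : K) (o : Option (Γ k)) :
    readReg k (o.map (Sigma.mk k)) = o := by
  cases o <;> simp [readReg]

/-- A statement of the first machine as a statement of the compound machine; instead of halting it
starts the transfer of the output. -/
def liftStmt {K₁ : Type} {Γ₁ : K₁ → Type} {Λ₁ σ₁ τ X : Type} :
    TM2.Stmt Γ₁ Λ₁ σ₁ → TM2.Stmt (sumΓ Γ₁ Γ) (Λ₁ ⊕ Option X) (σ₁ × τ)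
  | .push k f q => .push (.inl k) (fun v => f v.1) (liftStmt q)
  | .peek k f q => .peek (.inl k) (fun v o => (f v.1 o, v.2)) (liftStmt q)
  | .pop k f q => .pop (.inl k) (fun v o => (f v.1 o, v.2)) (liftStmt q)
  | .load f q => .load (fun v => (f v.1, v.2)) (liftStmt q)
  | .branch f q₁ q₂ => .branch (fun v => f v.1) (liftStmt q₁) (liftStmt q₂)
  | .goto f => .goto (fun v => .inl (f v.1))
  | .halt => .goto (fun _ => .inr none)

/-- A configuration of the first machine as a configuration of the compound machine. -/
def liftCfg {K₁ : Type} {Γ₁ : K₁ → Type} {Λ₁ σ₁ τ X : Type} (z : τ) (s : ∀ k, List (Γ k))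
    (c : TM2.Cfg Γ₁ Λ₁ σ₁) : TM2.Cfg (sumΓ Γ₁ Γ) (Λ₁ ⊕ Option X) (σ₁ × τ) :=
  ⟨some (c.l.elim (.inr none) .inl), (c.var, z), join c.stk s⟩

/-- A lifted statement touches only the left stacks and the first component of the internal state.
The one difference, that `halt` becomes a jump to the transfer, is built into `liftCfg`. -/
theorem stepAux_liftStmt {K₁ : Type} {Γ₁ : K₁ → Type} {Λ₁ σ₁ τ X : Type} [DecidableEq K₁]
    [DecidableEq K] (q : TM2.Stmt Γ₁ Λ₁ σ₁) (v : σ₁) (S : ∀ k, List (Γ₁ k)) (z : τ)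
    (s : ∀ k, List (Γ k)) :
    stepAux (liftStmt (X := X) q) (v, z) (join S s) = liftCfg z s (stepAux q v S) := by
  induction q generalizing v S with
  | push k f q ih => rw [liftStmt, stepAux, update_join_inl, ih]; rfl
  | peek k f q ih => rw [liftStmt, stepAux, stepAux]; exact ih _ _
  | pop k f q ih =>
    rw [liftStmt, stepAux, update_join_inl]; exact ih _ _
  | load f q ih => rw [liftStmt, stepAux, stepAux]; exact ih _ _
  | branch f q₁ q₂ ih₁ ih₂ =>
    rw [liftStmt, stepAux, stepAux, ih₁, ih₂]
    dsimp only
    cases f v <;> rfl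
  | goto f => rfl
  | halt => rfl

variable [DecidableEq K]

/-- An instruction as a statement of the compound machine. -/
def instrStmt {K₁ : Type} {Γ₁ : K₁ → Type} {Λ₁ σ₁ X : Type} :
    Prog.Instr Γ X → TM2.Stmt (sumΓ Γ₁ Γ) (Λ₁ ⊕ Option X) (σ₁ × Option (Σ k, Γ k))
  | .push k a x => .push (.inr k) (fun _ => a) (.goto fun _ => .inr (some x))
  -- The popped symbol passes through the register, because a jump can depend only on the internal
  -- state.
  | .pop k x => .pop (.inr k) (fun v o => (v.1, o.map (Sigma.mk k)))
      (.goto fun v => .inr (some (x (readReg k v.2))))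

/-- One round of the transfer of the stack `k₁` of the first machine to the stack `i`. -/
def transferStmt {K₁ : Type} {Γ₁ : K₁ → Type} {Λ₁ σ₁ X : Type} (k₁ : K₁) (i : K) (e : Γ₁ k₁ → Γ i)
    (d : Γ i) (x : X) : TM2.Stmt (sumΓ Γ₁ Γ) (Λ₁ ⊕ Option X) (σ₁ × Option (Σ k, Γ k)) :=
  .pop (.inl k₁) (fun v a => (v.1, a.map fun a => ⟨i, e a⟩))
    (.branch (fun v => v.2.isSome)
      -- The branch guarantees a symbol of `Γ i` in the register, so the default `d` is never used.
      (.push (.inr i) (fun v => (readReg i v.2).getD d) (.goto fun _ => .inr none))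
      (.goto fun _ => .inr (some x)))

theorem stepAux_transferStmt_nil {K₁ : Type} {Γ₁ : K₁ → Type} {Λ₁ σ₁ X : Type} [DecidableEq K₁]
    (k₁ : K₁) (i : K) (e : Γ₁ k₁ → Γ i) (d : Γ i) (x : X) (v : σ₁ × Option (Σ k, Γ k))
    (S : ∀ k, List (Γ₁ k)) (s : ∀ k, List (Γ k)) (h : S k₁ = []) :
    stepAux (transferStmt (Λ₁ := Λ₁) k₁ i e d x) v (join S s) =
      ⟨some (.inr (some x)), (v.1, none), join S s⟩ := by
  rw [transferStmt, stepAux, update_join_inl]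
  simp [join, h]
  simp [← h]

theorem stepAux_transferStmt_cons {K₁ : Type} {Γ₁ : K₁ → Type} {Λ₁ σ₁ X : Type} [DecidableEq K₁]
    (k₁ : K₁) (i : K) (e : Γ₁ k₁ → Γ i) (d : Γ i) (x : X) (v : σ₁ × Option (Σ k, Γ k))
    (S : ∀ k, List (Γ₁ k)) (s : ∀ k, List (Γ k)) {a : Γ₁ k₁} {l : List (Γ₁ k₁)} (h : S k₁ = a :: l) :
    stepAux (transferStmt (Λ₁ := Λ₁) k₁ i e d x) v (join S s) =
      ⟨some (.inr none), (v.1, some ⟨i, e a⟩),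
        join (update S k₁ l) (update s i (e a :: s i))⟩ := by
  rw [transferStmt, stepAux, update_join_inl]
  simp [join, h, readReg]
  rw [update_join_inr]

variable [Fintype K] [∀ k, Fintype (Γ k)]

/-- The machine that first runs `tm`, then moves its output, reversing it, to the stack `i`, and
then runs the code `C`, whose output is found on the stack `o`. -/
def comp (tm : FinTM2) (C : Prog.Code Γ) (i o : K) (e : tm.Γ tm.k₁ → Γ i) (d : Γ i) : FinTM2 where
  K := tm.K ⊕ K
  kDecidableEq := @instDecidableEqSum _ _ tm.kDecidableEq _
  kFin := @instFintypeSum _ _ tm.kFin _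
  k₀ := .inl tm.k₀
  k₁ := .inr o
  Γ := sumΓ tm.Γ Γ
  Λ := tm.Λ ⊕ Option (Option C.Λ)
  main := .inl tm.main
  ΛFin := @instFintypeSum _ _ tm.ΛFin (@instFintypeOption _ (@instFintypeOption _ C.fin))
  σ := tm.σ × Option (Σ k, Γ k)
  initialState := (tm.initialState, none)
  σFin := @instFintypeProd _ _ tm.σFin inferInstance
  Γk₀Fin := tm.Γk₀Fin
  m
    | .inl l => liftStmt (tm.m l)
    | .inr none => transferStmt tm.k₁ i e d C.start
    -- `haltList` demands the initial internal state, so the register is cleared before halting.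
    | .inr (some none) => .load (fun v => (v.1, none)) .halt
    | .inr (some (some l)) => instrStmt (C.instr l)

/-- Configurations of `comp tm C i o e d`. -/
def compCfg (tm : FinTM2) (C : Prog.Code Γ) (i o : K) (e : tm.Γ tm.k₁ → Γ i) (d : Γ i)
    (l : tm.Λ ⊕ Option (Option C.Λ)) (v : tm.σ) (z : Option (Σ k, Γ k)) (S : ∀ k, List (tm.Γ k))
    (s : ∀ k, List (Γ k)) : (comp tm C i o e d).Cfg :=
  (⟨some l, (v, z), join S s⟩ :
    TM2.Cfg (sumΓ tm.Γ Γ) (tm.Λ ⊕ Option (Option C.Λ)) (tm.σ × Option (Σ k, Γ k)))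

variable {tm : FinTM2} {C : Prog.Code Γ} {i o : K} {e : tm.Γ tm.k₁ → Γ i} {d : Γ i}

/-- The number of steps is unchanged: where `tm` halts, the same step of the compound machine jumps
to the transfer. -/
theorem reachIn_comp_first {n : ℕ} {c c' : tm.Cfg} (h : tm.ReachIn n c c') (hc' : c'.l = none) :
    (comp tm C i o e d).ReachIn n
      (compCfg tm C i o e d (c.l.elim (.inr none) .inl) c.var none c.stk fun _ => [])
      (compCfg tm C i o e d (.inr none) c'.var none c'.stk fun _ => []) := by
  induction n generalizing c with
  | zero => cases h; rw [hc']; rfl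
  | succ n ih =>
    obtain ⟨d, h1, h2⟩ := h.succ_inv
    obtain ⟨l, v, S⟩ := c
    cases l with
    | none => cases h1
    | some l =>
      cases h1
      rw [Nat.add_comm]
      refine ReachIn.trans (reachIn_one ?_) (ih h2)
      exact congrArg some (stepAux_liftStmt (tm.m l) v S none fun _ => [])

/-- The extra step is the round that finds the stack empty. Moving symbols between stacks reverses
the word, which is why programs expect their input in reverse. -/
theorem reachIn_comp_transfer (v : tm.σ) (S : ∀ k, List (tm.Γ k)) (l : List (tm.Γ tm.k₁))
    (hl : S tm.k₁ = l) (z : Option (Σ k, Γ k)) (s : ∀ k, List (Γ k)) :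
    ∃ z', (comp tm C i o e d).ReachIn (l.length + 1)
      (compCfg tm C i o e d (.inr none) v z S s)
      (compCfg tm C i o e d (.inr (some C.start)) v z' (update S tm.k₁ [])
        (update s i ((l.map e).reverse ++ s i))) := by
  induction l generalizing S z s with
  | nil =>
    refine ⟨none, reachIn_one (congrArg some ?_)⟩
    refine (stepAux_transferStmt_nil tm.k₁ i e d C.start (v, z) S s hl).trans ?_
    rw [show update S tm.k₁ [] = S by rw [← hl]; simp]
    simp [compCfg]
  | cons a l ih =>
    obtain ⟨z', h⟩ := ih (update S tm.k₁ l) (by simp) (some ⟨i, e a⟩) (update s i (e a :: s i))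
    refine ⟨z', ?_⟩
    rw [List.length_cons, Nat.add_comm]
    have h1 : (comp tm C i o e d).ReachIn 1 (compCfg tm C i o e d (.inr none) v z S s)
        (compCfg tm C i o e d (.inr none) v (some ⟨i, e a⟩) (update S tm.k₁ l)
          (update s i (e a :: s i))) :=
      reachIn_one (congrArg some
        (stepAux_transferStmt_cons tm.k₁ i e d C.start (v, z) S s hl))
    exact h1.trans (by simpa using h)

/-- `Reach` only bounds the number of steps while `ReachIn` counts them exactly, hence the
existential `m`. The final register content `z'` is whatever the last pop left. -/
theorem reachIn_comp_code {n : ℕ} {x : Option C.Λ} {s s' : ∀ k, List (Γ k)}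
    (h : Prog.Reach C.instr (x, s) (none, s') n) (v : tm.σ) (z : Option (Σ k, Γ k))
    (S : ∀ k, List (tm.Γ k)) :
    ∃ m ≤ n, ∃ z', (comp tm C i o e d).ReachIn m
      (compCfg tm C i o e d (.inr (some x)) v z S s)
      (compCfg tm C i o e d (.inr (some none)) v z' S s') := by
  generalize hc : (x, s) = c at h
  generalize hc' : (none, s') = c' at h
  induction h generalizing x s z with
  | refl c n => subst hc; cases hc'; exact ⟨0, by omega, z, rfl⟩
  | @step l s₁ c n _ ih =>
    cases hc
    cases hi : C.instr l with
    | push k a y =>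
      obtain ⟨m, hm, z', h⟩ := ih z rfl hc'
      refine ⟨1 + m, by omega, z', ReachIn.trans (reachIn_one ?_) h⟩
      refine congrArg some ?_
      change stepAux (instrStmt (C.instr l)) (v, z) (join S s₁) = _
      rw [hi, instrStmt, stepAux, update_join_inr]
      rfl
    | pop k y =>
      obtain ⟨m, hm, z', h⟩ := ih ((s₁ k).head?.map (Sigma.mk k)) rfl hc'
      refine ⟨1 + m, by omega, z', ReachIn.trans (reachIn_one ?_) h⟩
      refine congrArg some ?_
      change stepAux (instrStmt (C.instr l)) (v, z) (join S s₁) = _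
      rw [hi, instrStmt, stepAux, update_join_inr, stepAux]
      change _ = compCfg tm C i o e d _ _ _ _ _
      simp only [join, readReg_map]
      rfl

theorem length_initList_le (tm : FinTM2) (l : List (tm.Γ tm.k₀)) (k : tm.K) :
    ((initList tm l).stk k).length ≤ l.length := by
  by_cases h : k = tm.k₀
  · subst h; simp [initList]
  · simp [initList, h]

theorem haltList_stk (tm : FinTM2) (l : List (tm.Γ tm.k₁)) :
    (haltList tm l).stk = update (fun _ => []) tm.k₁ l := by
  funext k
  by_cases h : k = tm.k₁
  · subst h; simp [haltList]
  · simp [haltList, h]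

theorem initList_stk (tm : FinTM2) (l : List (tm.Γ tm.k₀)) :
    (initList tm l).stk = update (fun _ => []) tm.k₀ l := by
  funext k
  by_cases h : k = tm.k₀
  · subst h; simp [initList]
  · simp [initList, h]

theorem initList_comp (l : List (tm.Γ tm.k₀)) :
    initList (comp tm C i o e d) l =
      compCfg tm C i o e d (.inl tm.main) tm.initialState none (initList tm l).stk
        fun _ => [] := by
  have h := initList_stk (comp tm C i o e d) l
  rw [initList_stk]
  unfold compCfg
  rw [← update_join_inl]
  refine (congrArg (TM2.Cfg.mk _ _) (h.trans ?_))
  congr 1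
  funext k
  rcases k with k | k <;> rfl

theorem haltList_comp (l : List (Γ o)) :
    haltList (comp tm C i o e d) l =
      (⟨none, (tm.initialState, none), join (fun _ => []) (update (fun _ => []) o l)⟩ :
        TM2.Cfg (sumΓ tm.Γ Γ) (tm.Λ ⊕ Option (Option C.Λ)) (tm.σ × Option (Σ k, Γ k))) := by
  have h := haltList_stk (comp tm C i o e d) l
  rw [← update_join_inr]
  refine (congrArg (TM2.Cfg.mk _ _) (h.trans ?_))
  congr 1
  funext k
  rcases k with k | k <;> rfl

theorem eval_mono (p : Polynomial ℕ) {m n : ℕ} (h : m ≤ n) : p.eval m ≤ p.eval n := by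
  rw [Polynomial.eval_eq_sum, Polynomial.eval_eq_sum]
  exact Finset.sum_le_sum fun i _ => Nat.mul_le_mul_left _ (Nat.pow_le_pow_left h i)

/-- If the program `P`, given `x` in reverse on the stack `i` and with all other stacks empty,
produces `g x` on the stack `o` and empties all other stacks in polynomial time, then `g ∘ f` is
computable in polynomial time for every `f` that is. -/
theorem computableInPolyTime_comp {f g : List Bool → List Bool}
    (hf : TM2ComputableInPolyTime (id : List Bool → List Bool) (id : List Bool → List Bool) f)
    (P : Prog Γ) (i o : K) (ei : Bool ≃ Γ i) (eo : Bool ≃ Γ o) (p : Polynomial ℕ)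
    (hP : ∀ x : List Bool, Prog.Exec P (update (fun _ => []) i (x.map ei).reverse)
      (update (fun _ => []) o ((g x).map eo)) (p.eval x.length)) :
    Nonempty (TM2ComputableInPolyTime (id : List Bool → List Bool)
      (id : List Bool → List Bool) (g ∘ f)) := by
  classical
  obtain ⟨⟨tm, ein, eout⟩, time, hout⟩ := hf
  let _ := tm.ΛFin
  let B := ∑ l, pushCount (tm.m l)
  have hB : ∀ l, pushCount (tm.m l) ≤ B := fun l =>
    Finset.single_le_sum (f := fun l => pushCount (tm.m l)) (fun _ _ => Nat.zero_le _)
      (Finset.mem_univ l)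
  -- A bound for the output length of `tm`: the input length plus `B` symbols per step.
  let len : Polynomial ℕ := Polynomial.X + Polynomial.C B * time
  -- The summands pay for `tm`, for the transfer and for the program; the constant 2 is the last
  -- round of the transfer plus the halting step.
  have key : ∀ x : List Bool, ∃ n ≤ (time + len + p.comp len + 2).eval x.length,
      (comp tm P.code i o (ei ∘ eout) (ei true)).ReachIn n
        (initList _ (x.map ein.symm)) (haltList _ ((g (f x)).map eo)) := by
    intro x
    obtain ⟨⟨n, hn⟩, hnle⟩ := hout x
    simp only [id] at hnle
    have h1 : tm.ReachIn n (initList tm (x.map ein.symm)) (haltList tm ((f x).map eout.symm)) := hn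
    have hl : ((f x).map eout.symm).length ≤ len.eval x.length := by
      have := h1.length_le hB tm.k₁
      have h2 : ((haltList tm ((f x).map eout.symm)).stk tm.k₁) = (f x).map eout.symm := by
        simp [haltList]
      have h3 : ((initList tm (x.map ein.symm)).stk tm.k₁).length ≤ x.length := by
        exact (length_initList_le _ _ _).trans (by simp)
      rw [h2] at this
      simp only [len, Polynomial.eval_add, Polynomial.eval_mul, Polynomial.eval_X,
        Polynomial.eval_C]
      have := Nat.mul_le_mul_left B hnle
      omega
    have r1 := reachIn_comp_first (C := P.code) (i := i) (o := o) (e := ei ∘ eout) (d := ei true)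
      h1 rfl
    obtain ⟨z, r2⟩ := reachIn_comp_transfer (C := P.code) (i := i) (o := o) (e := ei ∘ eout)
      (d := ei true) tm.initialState (haltList tm ((f x).map eout.symm)).stk
      ((f x).map eout.symm) (by simp [haltList]) none (fun _ => [])
    have h2 : update (haltList tm ((f x).map eout.symm)).stk tm.k₁ [] = fun _ => [] := by
      rw [haltList_stk]; simp
    have h3 : ((f x).map eout.symm).map (ei ∘ eout) = (f x).map ei := by
      simp [List.map_map, Function.comp_def]
    rw [h2, h3, List.append_nil] at r2
    obtain ⟨m, hm, z', r3⟩ := reachIn_comp_code (i := i) (o := o) (e := ei ∘ eout)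
      (d := ei true) (hP (f x)).reach tm.initialState z (fun _ => [])
    have r4 : (comp tm P.code i o (ei ∘ eout) (ei true)).ReachIn 1 _
        (haltList _ ((g (f x)).map eo)) := reachIn_one (c := compCfg tm P.code i o (ei ∘ eout)
          (ei true) (.inr (some none)) tm.initialState z' (fun _ => [])
          (update (fun _ => []) o ((g (f x)).map eo))) (congrArg some (haltList_comp (C := P.code) (i := i)
            (e := ei ∘ eout) (d := ei true) ((g (f x)).map eo)).symm)
    refine ⟨n + (((f x).map eout.symm).length + 1) + m + 1, ?_, ?_⟩
    · simp only [Polynomial.eval_add, Polynomial.eval_comp, Polynomial.eval_ofNat]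
      have := eval_mono p (n := len.eval x.length) (m := (f x).length) (by simpa using hl)
      omega
    · have r0 := initList_comp (C := P.code) (i := i) (o := o) (e := ei ∘ eout) (d := ei true)
        (x.map ein.symm)
      have r5 := ((r1.trans r2).trans r3).trans r4
      exact (congrArg (fun c => ReachIn _ _ c _) r0).mpr r5
  refine ⟨⟨⟨comp tm P.code i o (ei ∘ eout) (ei true), ein, eo.symm⟩, time + len + p.comp len + 2, fun x => ?_⟩⟩
  choose n hn h using key
  exact ⟨⟨n x, h x⟩, hn x⟩

end Comp

end Turing.FinTM2

/-! ### Flatness, negation and renaming for modal logic -/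

namespace ML

variable {Φ Ψ : Type}

/-- Truth of an `ML`-formula in a world. -/
def Holds (K : KripkeModel.{u} Φ) : K.W → ML Φ → Prop
  | w, .prop p => w ∈ K.V p
  | w, .nprop p => w ∉ K.V p
  | w, .and φ ψ => Holds K w φ ∧ Holds K w ψ
  | w, .or φ ψ => Holds K w φ ∨ Holds K w ψ
  | w, .dia φ => ∃ v, K.R w v ∧ Holds K v φ
  | w, .box φ => ∀ v, K.R w v → Holds K v φ

theorem _root_.KripkeModel.subset_image_of_successor {K : KripkeModel.{u} Φ} {s : TeamSemantics}
    {T S : Set K.W} (h : TeamSemantics.Successor K s T S) :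
    S ⊆ K.image T ∧ T ⊆ K.preimage S := by
  cases s with
  | lax => exact h
  | strict =>
    obtain ⟨f, hf, rfl⟩ := h
    exact ⟨by rintro _ ⟨w, rfl⟩; exact ⟨w, w.2, hf w⟩, fun w hw => ⟨f ⟨w, hw⟩, ⟨_, rfl⟩, hf ⟨w, hw⟩⟩⟩

theorem _root_.TeamSemantics.Split.union {α : Type u} {s : TeamSemantics} {T T₁ T₂ : Set α}
    (h : s.Split T T₁ T₂) : T₁ ∪ T₂ = T := by
  cases s with
  | lax => exact h
  | strict => exact h.1

/-- Cutting off a complement is a legal split in both semantics, so this is the only kind of split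
ever constructed below. -/
theorem _root_.TeamSemantics.split_diff {α : Type u} (s : TeamSemantics) {T T₁ : Set α}
    (h : T₁ ⊆ T) : s.Split T T₁ (T \ T₁) := by
  cases s with
  | lax => exact Set.union_sdiff_cancel h
  | strict => exact ⟨Set.union_sdiff_cancel h, Set.inter_sdiff_self _ _⟩

/-- `ML` is flat, in lax as well as in strict semantics. -/
theorem sat_iff (s : TeamSemantics) (K : KripkeModel.{u} Φ) (φ : ML Φ) (T : Set K.W) :
    ML.Sat s K T φ ↔ ∀ w ∈ T, Holds K w φ := by
  induction φ generalizing T with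
  | prop p => rfl
  | nprop p => rfl
  | and φ ψ ih₁ ih₂ => simp only [ML.Sat, Holds, ih₁, ih₂, forall_and]
  | or φ ψ ih₁ ih₂ =>
    simp only [ML.Sat, Holds, ih₁, ih₂]
    constructor
    · rintro ⟨T₁, T₂, h, h₁, h₂⟩ w hw
      rw [← h.union] at hw
      exact hw.imp (h₁ w) (h₂ w)
    · intro h
      refine ⟨{w ∈ T | Holds K w φ}, _, s.split_diff (Set.sep_subset _ _), fun w hw => hw.2, ?_⟩
      intro w hw
      exact (h w hw.1).resolve_left fun h' => hw.2 ⟨hw.1, h'⟩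
  | dia φ ih =>
    simp only [ML.Sat, Holds, ih]
    constructor
    · rintro ⟨S, hS, h⟩ w hw
      obtain ⟨v, hv, hwv⟩ := (KripkeModel.subset_image_of_successor hS).2 hw
      exact ⟨v, hwv, h v hv⟩
    · intro h
      -- One chosen successor per world gives a strict successor team, which is also a lax one.
      choose f hf hf' using fun w : T => h w w.2
      refine ⟨Set.range f, ?_, by rintro _ ⟨w, rfl⟩; exact hf' w⟩
      have hs : TeamSemantics.Successor K .strict T (Set.range f) := ⟨f, hf, rfl⟩
      cases s with
      | lax => exact KripkeModel.subset_image_of_successor hs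
      | strict => exact hs
  | box φ ih =>
    simp only [ML.Sat, Holds, ih]
    exact ⟨fun h w hw v hv => h v ⟨w, hw, hv⟩, fun h v ⟨w, hw, hv⟩ => h w hw v hv⟩

/-- The negation normal form of the negation. -/
def neg : ML Φ → ML Φ
  | .prop p => .nprop p
  | .nprop p => .prop p
  | .and φ ψ => .or φ.neg ψ.neg
  | .or φ ψ => .and φ.neg ψ.neg
  | .dia φ => .box φ.neg
  | .box φ => .dia φ.neg

theorem holds_neg (K : KripkeModel.{u} Φ) (φ : ML Φ) (w : K.W) :
    Holds K w φ.neg ↔ ¬ Holds K w φ := by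
  induction φ generalizing w with
  | prop p => rfl
  | nprop p => simp [neg, Holds]
  | and φ ψ ih₁ ih₂ => simp only [neg, Holds, ih₁, ih₂]; tauto
  | or φ ψ ih₁ ih₂ => simp only [neg, Holds, ih₁, ih₂]; tauto
  | dia φ ih => simp [neg, Holds, ih]
  | box φ ih => simp [neg, Holds, ih]

/-- Renaming of proposition symbols. -/
def map (r : Φ → Ψ) : ML Φ → ML Ψ
  | .prop p => .prop (r p)
  | .nprop p => .nprop (r p)
  | .and φ ψ => .and (φ.map r) (ψ.map r)
  | .or φ ψ => .or (φ.map r) (ψ.map r)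
  | .dia φ => .dia (φ.map r)
  | .box φ => .box (φ.map r)

/-- The model interpreting `p` as `K` interprets `r p`. -/
def _root_.KripkeModel.comap (K : KripkeModel.{u} Ψ) (r : Φ → Ψ) : KripkeModel.{u} Φ where
  W := K.W
  nonempty := K.nonempty
  R := K.R
  V p := K.V (r p)

theorem holds_map (K : KripkeModel.{u} Ψ) (r : Φ → Ψ) (φ : ML Φ) (w : K.W) :
    Holds K w (φ.map r) ↔ Holds (K.comap r) w φ := by
  induction φ generalizing w with
  | prop p => rfl
  | nprop p => rfl
  | and φ ψ ih₁ ih₂ => simp only [map, Holds, ih₁, ih₂]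
  | or φ ψ ih₁ ih₂ => simp only [map, Holds, ih₁, ih₂]
  | dia φ ih => simp only [map, Holds, ih]; rfl
  | box φ ih => simp only [map, Holds, ih]; rfl

/-- `ML`-formulae as `EMinc`-formulae. -/
def toEMinc : ML Φ → EMinc Φ
  | .prop p => .prop p
  | .nprop p => .nprop p
  | .and φ ψ => .and φ.toEMinc ψ.toEMinc
  | .or φ ψ => .or φ.toEMinc ψ.toEMinc
  | .dia φ => .dia φ.toEMinc
  | .box φ => .box φ.toEMinc

theorem sat_toEMinc (s : TeamSemantics) (K : KripkeModel.{u} Φ) (φ : ML Φ) (T : Set K.W) :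
    EMinc.Sat s K T φ.toEMinc ↔ ∀ w ∈ T, Holds K w φ := by
  rw [← sat_iff s]
  induction φ generalizing T with
  | prop p => rfl
  | nprop p => rfl
  | and φ ψ ih₁ ih₂ => simp only [ML.Sat, toEMinc, EMinc.Sat, ih₁, ih₂]
  | or φ ψ ih₁ ih₂ => simp only [ML.Sat, toEMinc, EMinc.Sat, ih₁, ih₂]
  | dia φ ih => simp only [ML.Sat, toEMinc, EMinc.Sat, ih]
  | box φ ih => simp only [ML.Sat, toEMinc, EMinc.Sat, ih]

theorem isMinc_toEMinc (φ : ML Φ) : φ.toEMinc.IsMinc := by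
  induction φ <;> simp_all [toEMinc, EMinc.IsMinc]

theorem encode_toEMinc (φ : ML ℕ) : φ.toEMinc.encode = φ.encode := by
  induction φ <;> simp_all [toEMinc, EMinc.encode, ML.encode]

/-- A contradiction. -/
def bot (p : Φ) : ML Φ := .and (.prop p) (.nprop p)

theorem not_holds_bot (K : KripkeModel.{u} Φ) (p : Φ) (w : K.W) : ¬ Holds K w (bot p) :=
  fun h => h.2 h.1

end ML

/-! ### The translation into `Minc` preserves and reflects validity -/

namespace EMinc

variable {Φ Ψ : Type} (r : Φ → Ψ) (ι : ML Φ → Ψ) (p₀ : Ψ)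

/-- Renaming of proposition symbols by `r`, combined with the replacement of every parameter `χ` of
an inclusion atom by the proposition symbol `ι χ`. -/
def flatten : EMinc Φ → EMinc Ψ
  | .prop p => .prop (r p)
  | .nprop p => .nprop (r p)
  | .and φ ψ => .and φ.flatten ψ.flatten
  | .or φ ψ => .or φ.flatten ψ.flatten
  | .dia φ => .dia φ.flatten
  | .box φ => .box φ.flatten
  | .inc ps => .inc (ps.map fun c => (.prop (ι c.1), .prop (ι c.2)))

theorem isMinc_flatten (φ : EMinc Φ) : (φ.flatten r ι).IsMinc := by
  induction φ with
  | inc ps =>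
    simp only [flatten, IsMinc, List.forall_mem_map]
    exact fun _ _ => ⟨⟨_, rfl⟩, ⟨_, rfl⟩⟩
  | _ => simp_all [flatten, IsMinc]

/-- The symbol `ι χ` and the formula `χ` have different truth values. -/
def mismatch (χ : ML Φ) : ML Ψ :=
  .or (.and (.prop (ι χ)) (χ.map r).neg) (.and (.nprop (ι χ)) (χ.map r))

theorem holds_mismatch (K : KripkeModel.{u} Ψ) (χ : ML Φ) (w : K.W) :
    ML.Holds K w (mismatch r ι χ) ↔ ¬ (w ∈ K.V (ι χ) ↔ ML.Holds (K.comap r) w χ) := by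
  simp only [mismatch, ML.Holds, ML.holds_neg, ML.holds_map]
  tauto

/-- Some world that matters for `φ` is a mismatch for a parameter of an inclusion atom of `φ`. -/
def corrupt : EMinc Φ → ML Ψ
  | .prop _ => .bot p₀
  | .nprop _ => .bot p₀
  | .and φ ψ => .or φ.corrupt ψ.corrupt
  | .or φ ψ => .or φ.corrupt ψ.corrupt
  | .dia φ => .dia φ.corrupt
  | .box φ => .dia φ.corrupt
  | .inc ps => ps.foldr
      (fun c χ => .or (mismatch r ι c.1) (.or (mismatch r ι c.2) χ)) (.bot p₀)

theorem not_holds_corrupt_inc (K : KripkeModel.{u} Ψ) (ps : List (ML Φ × ML Φ)) (w : K.W) :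
    ¬ ML.Holds K w (corrupt r ι p₀ (.inc ps)) ↔ ∀ c ∈ ps,
      (w ∈ K.V (ι c.1) ↔ ML.Holds (K.comap r) w c.1) ∧
      (w ∈ K.V (ι c.2) ↔ ML.Holds (K.comap r) w c.2) := by
  simp only [corrupt]
  induction ps with
  | nil => simp [ML.not_holds_bot]
  | cons c ps ih =>
    simp only [List.foldr_cons, ML.Holds, not_or, ih, holds_mismatch, not_not, List.mem_cons,
      forall_eq_or_imp, and_assoc]

/-- Incorruptness is inherited by every team that the semantics may examine: subteams of a split,
successor teams `S ⊆ R[T]`, and `R[T]` itself. For this reason `corrupt` uses `dia` under both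
modalities and `or` under both connectives. At an inclusion atom all names are then correct, so the
flattened atom compares the same truth values. -/
theorem sat_flatten_iff (s : TeamSemantics) (K : KripkeModel.{u} Ψ) (φ : EMinc Φ) (T : Set K.W)
    (h : ∀ w ∈ T, ¬ ML.Holds K w (φ.corrupt r ι p₀)) :
    Sat s K T (φ.flatten r ι) ↔ Sat s (K.comap r) T φ := by
  induction φ generalizing T with
  | prop p => rfl
  | nprop p => rfl
  | and φ ψ ih₁ ih₂ =>
    simp only [corrupt, ML.Holds, not_or] at h
    simp only [flatten, Sat]
    exact and_congr (ih₁ T fun w hw => (h w hw).1) (ih₂ T fun w hw => (h w hw).2)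
  | or φ ψ ih₁ ih₂ =>
    simp only [corrupt, ML.Holds, not_or] at h
    simp only [flatten, Sat]
    refine exists_congr fun T₁ => exists_congr fun T₂ => and_congr_right fun hT => ?_
    exact and_congr (ih₁ T₁ fun w hw => (h w (hT.union ▸ Or.inl hw)).1)
      (ih₂ T₂ fun w hw => (h w (hT.union ▸ Or.inr hw)).2)
  | dia φ ih =>
    simp only [corrupt, ML.Holds, not_exists, not_and] at h
    simp only [flatten, Sat]
    refine exists_congr fun S => ?_
    have : TeamSemantics.Successor (K.comap r) s T S ↔ TeamSemantics.Successor K s T S := by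
      cases s <;> rfl
    rw [this]
    refine and_congr_right fun hS => ih S fun v hv => ?_
    obtain ⟨w, hw, hwv⟩ := (KripkeModel.subset_image_of_successor hS).1 hv
    exact h w hw v hwv
  | box φ ih =>
    simp only [corrupt, ML.Holds, not_exists, not_and] at h
    simp only [flatten, Sat]
    exact ih _ fun v ⟨w, hw, hwv⟩ => h w hw v hwv
  | inc ps =>
    simp only [not_holds_corrupt_inc] at h
    simp only [flatten, Sat, List.forall_mem_map, ML.sat_iff, Set.mem_singleton_iff, forall_eq,
      ML.Holds]
    refine forall₂_congr fun w hw => exists_congr fun v => and_congr_right fun hv =>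
      forall₂_congr fun c hc => ?_
    rw [(h w hw c hc).1, (h v hv c hc).2]

/-- The translation of `EMinc` to `Minc`. -/
def toMinc (φ : EMinc Φ) : EMinc Ψ :=
  .or (φ.corrupt r ι p₀).toEMinc (φ.flatten r ι)

theorem isMinc_toMinc (φ : EMinc Φ) : (φ.toMinc r ι p₀).IsMinc :=
  ⟨ML.isMinc_toEMinc _, isMinc_flatten _ _ _⟩

theorem valid_toMinc_iff (s : TeamSemantics) (hr : r.Injective) (hι : ι.Injective)
    (hrι : ∀ p χ, r p ≠ ι χ) (φ : EMinc Φ) :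
    Valid.{u} s (φ.toMinc r ι p₀) ↔ Valid.{u} s φ := by
  constructor
  · rintro h ⟨W, hW, R, V⟩ T
    -- Old symbols keep their meaning and every name is true exactly where the named formula is.
    -- Injectivity of `r` and `ι` and disjointness of their ranges keep the clauses from
    -- interfering.
    let K' : KripkeModel.{u} Ψ := ⟨W, hW, R, fun q =>
      {w | (∃ p, q = r p ∧ w ∈ V p) ∨ ∃ χ, q = ι χ ∧ ML.Holds ⟨W, hW, R, V⟩ w χ}⟩
    have hK : (fun p => K'.V (r p)) = V := by
      simp only [K', hr.eq_iff, hrι, false_and, exists_false, or_false, exists_eq_left',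
        Set.ofPred_mem_eq]
    have hV : ∀ χ (w : W), w ∈ K'.V (ι χ) ↔ ML.Holds (K'.comap r) w χ := by
      intro χ w
      change _ ↔ ML.Holds ⟨W, hW, R, fun p => K'.V (r p)⟩ w χ
      rw [hK]
      simp only [K', Set.mem_ofPred_eq, (hrι _ _).symm, false_and, exists_false, false_or,
        hι.eq_iff, exists_eq_left']
    have hc : ∀ (φ : EMinc Φ) (w : W), ¬ ML.Holds K' w (φ.corrupt r ι p₀) := by
      intro φ
      induction φ with
      | prop p => exact ML.not_holds_bot K' p₀
      | nprop p => exact ML.not_holds_bot K' p₀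
      | and φ ψ ih₁ ih₂ => exact fun w h => h.elim (ih₁ w) (ih₂ w)
      | or φ ψ ih₁ ih₂ => exact fun w h => h.elim (ih₁ w) (ih₂ w)
      | dia φ ih => exact fun w ⟨v, _, h⟩ => ih v h
      | box φ ih => exact fun w ⟨v, _, h⟩ => ih v h
      | inc ps =>
        exact fun w => (not_holds_corrupt_inc r ι p₀ K' ps w).2 fun c _ => ⟨hV _ _, hV _ _⟩
    obtain ⟨T₁, T₂, hT, h₁, h₂⟩ := h K' T
    -- No world of `K'` is corrupt, so the half satisfying `corrupt` is empty.
    have : T₂ = T := by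
      rw [← hT.union, Set.eq_empty_of_forall_notMem
        fun w hw => hc φ w ((ML.sat_toEMinc _ _ _ _).1 h₁ w hw), Set.empty_union]
    subst this
    rw [sat_flatten_iff r ι p₀ s K' φ _ fun w _ => hc φ w] at h₂
    change Sat s ⟨W, hW, R, fun p => K'.V (r p)⟩ T₂ φ at h₂
    rwa [hK] at h₂
  · intro h K T
    -- The corrupt worlds satisfy the left disjunct by flatness; the others satisfy the flattened
    -- formula because φ is valid.
    refine ⟨{w ∈ T | ML.Holds K w (φ.corrupt r ι p₀)}, _, s.split_diff (Set.sep_subset _ _), ?_, ?_⟩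
    · rw [ML.sat_toEMinc]
      exact fun w hw => hw.2
    · rw [sat_flatten_iff r ι p₀]
      · exact h _ _
      · exact fun w hw hw' => hw.2 ⟨hw.1, hw'⟩

end EMinc

/-! ### Codes of numbers and unique readability of codes of formulae -/

open Computability

theorem encodePosNum_getLastD (n : PosNum) (b : Bool) : (encodePosNum n).getLastD b = true := by
  induction n generalizing b with
  | one => rfl
  | bit0 n ih => rw [encodePosNum, List.getLastD_cons, ih]
  | bit1 n ih => rw [encodePosNum, List.getLastD_cons, ih]

/-- Binary codes are little-endian, so a nonempty one ends with its leading digit 1; the default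
`true` admits the empty code of zero. Together with `exists_encodeNat` this describes exactly which
words are codes of numbers. -/
theorem encodeNat_getLastD (n : ℕ) : (encodeNat n).getLastD true = true := by
  rw [encodeNat]
  cases (n : Num) with
  | zero => rfl
  | pos p => exact encodePosNum_getLastD p _

theorem exists_encodePosNum (b : Bool) (l : List Bool) (h : (b :: l).getLastD true = true) :
    ∃ p : PosNum, encodePosNum p = b :: l := by
  induction l generalizing b with
  | nil =>
    cases b
    · cases h
    · exact ⟨.one, rfl⟩
  | cons c l ih =>
    obtain ⟨p, hp⟩ := ih c h
    cases b
    · exact ⟨.bit0 p, by rw [encodePosNum, hp]⟩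
    · exact ⟨.bit1 p, by rw [encodePosNum, hp]⟩

theorem exists_encodeNat (l : List Bool) (h : l.getLastD true = true) :
    ∃ n : ℕ, encodeNat n = l := by
  cases l with
  | nil => exact ⟨0, rfl⟩
  | cons b l =>
    obtain ⟨p, hp⟩ := exists_encodePosNum b l h
    refine ⟨p, ?_⟩
    rw [encodeNat, ← hp]
    simp [encodeNum]

theorem encodeNat_injective : encodeNat.Injective := fun m n h => by
  rw [← decode_encodeNat m, h, decode_encodeNat]

/-- The self-delimiting code of a word. -/
def delimit (l : List Bool) : List Bool := l.flatMap (fun b => [true, b]) ++ [false]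

theorem encodeIndex_eq (n : ℕ) : encodeIndex n = delimit (encodeNat n) := rfl

@[simp] theorem delimit_nil : delimit [] = [false] := rfl

@[simp] theorem delimit_cons (b : Bool) (l : List Bool) :
    delimit (b :: l) = true :: b :: delimit l := rfl

/-- The flag before each digit announces whether another digit follows, so a delimited word can be
split off from any remainder. -/
theorem delimit_append_inj {l l' r r' : List Bool} (h : delimit l ++ r = delimit l' ++ r') :
    l = l' ∧ r = r' := by
  induction l generalizing l' with
  | nil => cases l' <;> simp_all
  | cons b l ih =>
    cases l' with
    | nil => simp at h
    | cons b' l' =>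
      simp only [delimit_cons, List.cons_append, List.cons.injEq, true_and] at h
      obtain ⟨rfl, h⟩ := h
      obtain ⟨rfl, rfl⟩ := ih h
      exact ⟨rfl, rfl⟩

theorem encodeIndex_append_inj {m n : ℕ} {r r' : List Bool}
    (h : encodeIndex m ++ r = encodeIndex n ++ r') : m = n ∧ r = r' :=
  (delimit_append_inj h).imp_left fun h => encodeNat_injective h

/-- In prefix notation the first three bits determine the connective. The arbitrary remainders are
needed for the induction, since the code of a first argument is followed by that of the second. -/
theorem ML.encode_append_inj {φ ψ : ML ℕ} {r r' : List Bool}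
    (h : φ.encode ++ r = ψ.encode ++ r') : φ = ψ ∧ r = r' := by
  induction φ generalizing ψ r r' with
  | prop p =>
    cases ψ <;> simp [ML.encode] at h ⊢
    exact encodeIndex_append_inj h
  | nprop p =>
    cases ψ <;> simp [ML.encode] at h ⊢
    exact encodeIndex_append_inj h
  | and φ φ' ih ih' =>
    cases ψ <;> simp [ML.encode] at h ⊢
    obtain ⟨rfl, h'⟩ := ih h
    obtain ⟨rfl, rfl⟩ := ih' h'
    simp
  | or φ φ' ih ih' =>
    cases ψ <;> simp [ML.encode] at h ⊢
    obtain ⟨rfl, h'⟩ := ih h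
    obtain ⟨rfl, rfl⟩ := ih' h'
    simp
  | dia φ ih =>
    cases ψ <;> simp [ML.encode] at h ⊢
    exact ih h
  | box φ ih =>
    cases ψ <;> simp [ML.encode] at h ⊢
    exact ih h

theorem ML.encode_injective : ML.encode.Injective := fun φ ψ h =>
  (ML.encode_append_inj (r := []) (r' := []) (by simpa using h)).1

/-- The code of the list of parameters of an inclusion atom. -/
def encodePairs (ps : List (ML ℕ × ML ℕ)) : List Bool :=
  ps.flatMap (fun c => [true] ++ c.1.encode ++ c.2.encode) ++ [false]

@[simp] theorem encodePairs_nil : encodePairs [] = [false] := rfl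

@[simp] theorem encodePairs_cons (c : ML ℕ × ML ℕ) (ps : List (ML ℕ × ML ℕ)) :
    encodePairs (c :: ps) = true :: (c.1.encode ++ (c.2.encode ++ encodePairs ps)) := by
  simp [encodePairs]

@[simp] theorem EMinc.encode_inc (ps : List (ML ℕ × ML ℕ)) :
    (EMinc.inc ps).encode = true :: true :: false :: encodePairs ps := by
  simp [EMinc.encode, encodePairs]

theorem encodePairs_append_inj {ps qs : List (ML ℕ × ML ℕ)} {r r' : List Bool}
    (h : encodePairs ps ++ r = encodePairs qs ++ r') : ps = qs ∧ r = r' := by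
  induction ps generalizing qs with
  | nil => cases qs <;> simp_all
  | cons c ps ih =>
    cases qs with
    | nil => simp at h
    | cons d qs =>
      simp only [encodePairs_cons, List.cons_append, List.append_assoc, List.cons.injEq,
        true_and] at h
      obtain ⟨h1, h⟩ := ML.encode_append_inj h
      obtain ⟨h2, h⟩ := ML.encode_append_inj h
      obtain ⟨rfl, rfl⟩ := ih h
      rw [Prod.ext h1 h2]
      exact ⟨rfl, rfl⟩

theorem EMinc.encode_append_inj {φ ψ : EMinc ℕ} {r r' : List Bool}
    (h : φ.encode ++ r = ψ.encode ++ r') : φ = ψ ∧ r = r' := by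
  induction φ generalizing ψ r r' with
  | prop p =>
    cases ψ <;> simp [EMinc.encode] at h ⊢
    exact encodeIndex_append_inj h
  | nprop p =>
    cases ψ <;> simp [EMinc.encode] at h ⊢
    exact encodeIndex_append_inj h
  | and φ φ' ih ih' =>
    cases ψ <;> simp [EMinc.encode] at h ⊢
    obtain ⟨rfl, h'⟩ := ih h
    obtain ⟨rfl, rfl⟩ := ih' h'
    simp
  | or φ φ' ih ih' =>
    cases ψ <;> simp [EMinc.encode] at h ⊢
    obtain ⟨rfl, h'⟩ := ih h
    obtain ⟨rfl, rfl⟩ := ih' h'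
    simp
  | dia φ ih =>
    cases ψ <;> simp [EMinc.encode] at h ⊢
    exact ih h
  | box φ ih =>
    cases ψ <;> simp [EMinc.encode] at h ⊢
    exact ih h
  | inc ps =>
    cases ψ with
    | inc qs => simpa using encodePairs_append_inj (by simpa using h)
    | _ => simp [EMinc.encode] at h

theorem EMinc.encode_injective : EMinc.encode.Injective := fun φ ψ h =>
  (EMinc.encode_append_inj (r := []) (r' := []) (by simpa using h)).1

/-! ### A pushdown automaton recognizing codes of formulae -/

/-- The stack symbols of a pushdown automaton recognizing codes of formulae. A symbol stands for
what remains to be read: a (partially read) formula, where the flag `r` tells whether it is a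
parameter of an inclusion atom; a parameter that has not been begun; a (partially read) index; the
remaining parameters of an inclusion atom; or something impossible. -/
inductive PSym : Type
  | tok0 (r : Bool)
  | tok1 (r a : Bool)
  | tok2 (r a b : Bool)
  | par
  | idx (r ok : Bool)
  | idx1 (r : Bool)
  | pairs
  | dead
  deriving DecidableEq, Fintype

namespace PSym

/-- Reading a bit replaces the topmost stack symbol by a list of symbols. If `mc` is set, only
proposition symbols are accepted as parameters. -/
def step (mc : Bool) : PSym → Bool → List PSym
  | tok0 r, a => [tok1 r a]
  | par, a => [tok1 true a]
  | tok1 r a, b => [tok2 r a b]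
  -- With `mc` and `r` set, only the token 000 of a proposition symbol survives.
  | tok2 r false false, c => if mc && r && c then [dead] else [idx r true]
  | tok2 r false true, _ => if mc && r then [dead] else [tok0 r, tok0 r]
  | tok2 r true false, _ => if mc && r then [dead] else [tok0 r]
  | tok2 r true true, c => if r || c then [dead] else [pairs]
  | idx r _, true => [idx1 r]
  | idx _ ok, false => if ok then [] else [dead]
  | idx1 r, b => [idx r b]
  | pairs, true => [par, par, pairs]
  | pairs, false => []
  | dead, _ => [dead]

/-- The codes of formulae (`r = false`) or parameters (`r = true`). -/
def Code (mc : Bool) : Bool → Set (List Bool)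
  | false => {w | ∃ φ : EMinc ℕ, (mc = true → φ.IsMinc) ∧ φ.encode = w}
  | true => {w | ∃ χ : ML ℕ, (mc = true → ∃ p, χ = .prop p) ∧ χ.encode = w}

/-- The words a stack symbol stands for. -/
def Lang (mc : Bool) : PSym → Set (List Bool)
  | tok0 r => Code mc r
  | tok1 r a => {w | a :: w ∈ Code mc r}
  | tok2 r a b => {w | a :: b :: w ∈ Code mc r}
  | par => Code mc true
  | idx _ ok => {w | ∃ l : List Bool, l.getLastD ok = true ∧ delimit l = w}
  | idx1 _ => {w | ∃ b l, (b :: l).getLastD true = true ∧ b :: delimit l = w}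
  | pairs => {w | ∃ ps : List (ML ℕ × ML ℕ), (mc = true → (EMinc.inc ps).IsMinc) ∧
      encodePairs ps = w}
  | dead => ∅

/-- The words a stack stands for. -/
def LangL (mc : Bool) : List PSym → Set (List Bool)
  | [] => {[]}
  | s :: st => {w | ∃ u v, u ∈ Lang mc s ∧ v ∈ LangL mc st ∧ u ++ v = w}

theorem langL_append (mc : Bool) (st st' : List PSym) (w : List Bool) :
    w ∈ LangL mc (st ++ st') ↔ ∃ u v, u ∈ LangL mc st ∧ v ∈ LangL mc st' ∧ u ++ v = w := by
  induction st generalizing w with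
  | nil => simp [LangL]
  | cons s st ih =>
    simp only [List.cons_append, LangL, Set.mem_ofPred_eq, ih]
    constructor
    · rintro ⟨u, _, hu, ⟨v, v', hv, hv', rfl⟩, rfl⟩
      exact ⟨u ++ v, v', ⟨u, v, hu, hv, rfl⟩, hv', by simp⟩
    · rintro ⟨_, v', ⟨u, v, hu, hv, rfl⟩, hv', rfl⟩
      exact ⟨u, v ++ v', hu, ⟨v, v', hv, hv', rfl⟩, by simp⟩

theorem langL_singleton (mc : Bool) (s : PSym) : LangL mc [s] = Lang mc s := by
  ext w
  simp [LangL]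

/-- The flag of `idx` tells whether the index may end here: the last digit read was 1, or no digit
has been read. By `exists_encodeNat` this admits exactly the codes of numbers. -/
theorem mem_idx_true (mc r : Bool) (w : List Bool) :
    w ∈ Lang mc (idx r true) ↔ ∃ n, encodeIndex n = w := by
  constructor
  · rintro ⟨l, hl, rfl⟩
    obtain ⟨n, rfl⟩ := exists_encodeNat l hl
    exact ⟨n, rfl⟩
  · rintro ⟨n, rfl⟩
    exact ⟨_, encodeNat_getLastD n, rfl⟩

/-- The third bit completes the token, after which exactly the arguments of the connective remain to
be read. The proof runs through all tokens. -/
theorem derivative_tok2 (mc r a b c : Bool) (w : List Bool) :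
    a :: b :: c :: w ∈ Code mc r ↔ w ∈ LangL mc (step mc (tok2 r a b) c) := by
  have hd : ∀ w, w ∉ LangL mc [dead] := fun w ⟨_, _, h, _⟩ => h
  cases r with
  | false =>
    cases a <;> cases b
    · simp only [step, Bool.and_false, Bool.false_and, Bool.false_eq_true, if_false,
        langL_singleton, mem_idx_true]
      constructor
      · rintro ⟨φ, _, h⟩
        cases φ <;> simp [EMinc.encode] at h
        · exact ⟨_, h.2⟩
        · exact ⟨_, h.2⟩
      · rintro ⟨n, rfl⟩
        cases c
        · exact ⟨.prop n, fun _ => trivial, by simp [EMinc.encode]⟩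
        · exact ⟨.nprop n, fun _ => trivial, by simp [EMinc.encode]⟩
    · simp only [step, Bool.and_false, Bool.false_eq_true, if_false]
      constructor
      · rintro ⟨φ, hφ, h⟩
        cases φ <;> simp [EMinc.encode] at h
        · exact ⟨_, _, ⟨_, fun m => (hφ m).1, rfl⟩,
            (langL_singleton mc _).ge ⟨_, fun m => (hφ m).2, rfl⟩, h.2⟩
        · exact ⟨_, _, ⟨_, fun m => (hφ m).1, rfl⟩,
            (langL_singleton mc _).ge ⟨_, fun m => (hφ m).2, rfl⟩, h.2⟩
      · rintro ⟨_, _, ⟨φ, hφ, rfl⟩, h, rfl⟩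
        rw [langL_singleton] at h
        obtain ⟨ψ, hψ, rfl⟩ := h
        cases c
        · exact ⟨.and φ ψ, fun m => ⟨hφ m, hψ m⟩, by simp [EMinc.encode]⟩
        · exact ⟨.or φ ψ, fun m => ⟨hφ m, hψ m⟩, by simp [EMinc.encode]⟩
    · simp only [step, Bool.and_false, Bool.false_eq_true, if_false, langL_singleton]
      constructor
      · rintro ⟨φ, hφ, h⟩
        cases φ <;> simp [EMinc.encode] at h
        · refine ⟨_, ?_, h.2⟩
          exact hφ
        · refine ⟨_, ?_, h.2⟩
          exact hφ
      · rintro ⟨φ, hφ, rfl⟩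
        cases c
        · exact ⟨.dia φ, hφ, by simp [EMinc.encode]⟩
        · exact ⟨.box φ, hφ, by simp [EMinc.encode]⟩
    · cases c
      · simp only [step, Bool.or_false, Bool.false_eq_true, if_false, langL_singleton]
        constructor
        · rintro ⟨φ, hφ, h⟩
          cases φ with
          | inc ps => exact ⟨ps, hφ, by simpa using h⟩
          | _ => simp [EMinc.encode] at h
        · rintro ⟨ps, hps, rfl⟩
          exact ⟨.inc ps, hps, by simp⟩
      · simp only [step, Bool.or_true, if_true, hd, iff_false]
        rintro ⟨φ, hφ, h⟩
        cases φ <;> simp [EMinc.encode] at h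
  | true =>
    cases mc with
    | true =>
      cases a <;> cases b
      · cases c
        · simp only [step, Bool.and_false, Bool.false_eq_true, if_false, langL_singleton,
            mem_idx_true]
          constructor
          · rintro ⟨χ, _, h⟩
            cases χ <;> simp [ML.encode] at h
            exact ⟨_, h⟩
          · rintro ⟨n, rfl⟩
            exact ⟨.prop n, fun _ => ⟨n, rfl⟩, by simp [ML.encode]⟩
        · simp only [step, Bool.and_true, if_true, hd, iff_false]
          rintro ⟨χ, hχ, h⟩
          obtain ⟨p, rfl⟩ := hχ rfl
          simp [ML.encode] at h
      all_goals
        simp only [step, Bool.and_true, Bool.true_or, if_true, hd, iff_false]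
        rintro ⟨χ, hχ, h⟩
        obtain ⟨p, rfl⟩ := hχ rfl
        simp [ML.encode] at h
    | false =>
      cases a <;> cases b
      · simp only [step, Bool.false_and, Bool.false_eq_true, if_false, langL_singleton,
          mem_idx_true]
        constructor
        · rintro ⟨φ, _, h⟩
          cases φ <;> simp [ML.encode] at h
          · exact ⟨_, h.2⟩
          · exact ⟨_, h.2⟩
        · rintro ⟨n, rfl⟩
          cases c
          · exact ⟨.prop n, by simp, by simp [ML.encode]⟩
          · exact ⟨.nprop n, by simp, by simp [ML.encode]⟩
      · simp only [step, Bool.false_and, Bool.false_eq_true, if_false]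
        constructor
        · rintro ⟨φ, hφ, h⟩
          cases φ <;> simp [ML.encode] at h
          · exact ⟨_, _, ⟨_, by simp, rfl⟩, (langL_singleton false _).ge ⟨_, by simp, rfl⟩, h.2⟩
          · exact ⟨_, _, ⟨_, by simp, rfl⟩, (langL_singleton false _).ge ⟨_, by simp, rfl⟩, h.2⟩
        · rintro ⟨_, _, ⟨φ, hφ, rfl⟩, h, rfl⟩
          rw [langL_singleton] at h
          obtain ⟨ψ, hψ, rfl⟩ := h
          cases c
          · exact ⟨.and φ ψ, by simp, by simp [ML.encode]⟩
          · exact ⟨.or φ ψ, by simp, by simp [ML.encode]⟩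
      · simp only [step, Bool.false_and, Bool.false_eq_true, if_false, langL_singleton]
        constructor
        · rintro ⟨φ, hφ, h⟩
          cases φ <;> simp [ML.encode] at h
          · exact ⟨_, by simp, h.2⟩
          · exact ⟨_, by simp, h.2⟩
        · rintro ⟨φ, hφ, rfl⟩
          cases c
          · exact ⟨.dia φ, by simp, by simp [ML.encode]⟩
          · exact ⟨.box φ, by simp, by simp [ML.encode]⟩
      · simp only [step, Bool.true_or, if_true, hd, iff_false]
        rintro ⟨φ, hφ, h⟩
        cases φ <;> simp [ML.encode] at h

theorem nil_notMem_code (mc r : Bool) : [] ∉ Code mc r := by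
  cases r <;> rintro ⟨φ, _, h⟩ <;> cases φ <;> simp [EMinc.encode, ML.encode] at h

/-- `step` computes Brzozowski derivatives: after one bit, what remains of a code is again a
concatenation of words that stack symbols stand for. -/
theorem derivative (mc : Bool) (s : PSym) (b : Bool) (w : List Bool) :
    b :: w ∈ Lang mc s ↔ w ∈ LangL mc (step mc s b) := by
  cases s with
  | tok0 r => simp only [step, langL_singleton]; rfl
  | tok1 r a => simp only [step, langL_singleton]; rfl
  | tok2 r a c => exact derivative_tok2 mc r a c b w
  | par => simp only [step, langL_singleton]; rfl
  | idx r ok =>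
    cases b with
    | true =>
      simp only [step, langL_singleton]
      constructor
      · rintro ⟨l, hl, h⟩
        cases l with
        | nil => simp at h
        | cons b l =>
          refine ⟨b, l, ?_, by simpa using h⟩
          rw [List.getLastD_cons] at hl ⊢
          exact hl
      · rintro ⟨b, l, hl, rfl⟩
        refine ⟨b :: l, ?_, rfl⟩
        rw [List.getLastD_cons] at hl ⊢
        exact hl
    | false =>
      cases ok with
      | true =>
        simp only [step, if_true, LangL, Set.mem_singleton_iff]
        constructor
        · rintro ⟨l, hl, h⟩
          cases l <;> simp_all
        · rintro rfl
          exact ⟨[], rfl, rfl⟩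
      | false =>
        simp only [step, Bool.false_eq_true, if_false, langL_singleton]
        constructor
        · rintro ⟨l, hl, h⟩
          cases l <;> simp_all
        · exact False.elim
  | idx1 r =>
    simp only [step, langL_singleton]
    constructor
    · rintro ⟨b', l, hl, h⟩
      simp only [List.cons.injEq] at h
      obtain ⟨rfl, rfl⟩ := h
      rw [List.getLastD_cons] at hl
      exact ⟨l, hl, rfl⟩
    · rintro ⟨l, hl, rfl⟩
      exact ⟨b, l, by rw [List.getLastD_cons]; exact hl, rfl⟩
  | pairs =>
    cases b with
    | true =>
      simp only [step, LangL, Lang, Set.mem_ofPred_eq]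
      constructor
      · rintro ⟨ps, hps, h⟩
        cases ps with
        | nil => simp at h
        | cons c ps =>
          simp only [encodePairs_cons, List.cons.injEq, true_and] at h
          have h' := fun m => List.forall_mem_cons.1 (hps m)
          exact ⟨_, _, ⟨_, fun m => (h' m).1.1, rfl⟩, ⟨_, _, ⟨_, fun m => (h' m).1.2, rfl⟩,
            ⟨_, _, ⟨_, fun m => (h' m).2, rfl⟩, rfl, rfl⟩, rfl⟩, by simpa using h⟩
      · rintro ⟨_, _, ⟨χ, hχ, rfl⟩, ⟨_, _, ⟨χ', hχ', rfl⟩, ⟨_, _, ⟨ps, hps, rfl⟩, rfl, rfl⟩, rfl⟩,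
          rfl⟩
        exact ⟨(χ, χ') :: ps, fun m => List.forall_mem_cons.2 ⟨⟨hχ m, hχ' m⟩, hps m⟩, by simp⟩
    | false =>
      simp only [step, LangL, Set.mem_singleton_iff]
      constructor
      · rintro ⟨ps, _, h⟩
        cases ps <;> simp_all
      · rintro rfl
        exact ⟨[], fun _ => by simp [EMinc.IsMinc], rfl⟩
  | dead => simp only [step, langL_singleton]; rfl

/-- As no symbol stands for the empty word, a nonempty stack cannot accept at the end of the input,
and the next bit always belongs to the topmost symbol. -/
theorem nil_notMem_lang (mc : Bool) (s : PSym) : [] ∉ Lang mc s := by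
  cases s with
  | tok0 r => exact nil_notMem_code mc r
  | tok1 r a =>
    cases r <;> rintro ⟨φ, _, h⟩ <;> cases φ <;> simp [EMinc.encode, ML.encode] at h
  | tok2 r a b =>
    cases r <;> rintro ⟨φ, _, h⟩ <;> cases φ <;> simp [EMinc.encode, ML.encode] at h
  | par => exact nil_notMem_code mc true
  | idx r ok => rintro ⟨l, _, h⟩; cases l <;> simp at h
  | idx1 r => rintro ⟨b, l, _, h⟩; simp at h
  | pairs => rintro ⟨ps, _, h⟩; cases ps <;> simp at h
  | dead => exact id

/-- The automaton reading a bit. -/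
def next (mc : Bool) (st : List PSym) (b : Bool) : List PSym :=
  step mc (st.headD dead) b ++ st.tail

/-- The automaton accepts exactly the words its stack stands for. -/
theorem foldl_next_eq_nil (mc : Bool) (st : List PSym) (w : List Bool) :
    w.foldl (next mc) st = [] ↔ w ∈ LangL mc st := by
  induction w generalizing st with
  | nil =>
    cases st with
    | nil => simp [LangL]
    | cons s st =>
      simp only [List.foldl_nil, reduceCtorEq, false_iff]
      rintro ⟨u, v, hu, _, h⟩
      rw [List.append_eq_nil_iff] at h
      exact nil_notMem_lang mc s (h.1 ▸ hu)
  | cons b w ih =>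
    rw [List.foldl_cons, ih, next, langL_append]
    cases st with
    | nil =>
      -- A bit read on the empty stack puts `dead` there, so a complete code followed by further
      -- bits is rejected.
      simp only [List.headD_nil, step, langL_singleton, LangL, Set.mem_singleton_iff, reduceCtorEq,
        iff_false]
      rintro ⟨u, v, hu, _⟩
      exact hu
    | cons s st =>
      simp only [List.headD_cons, List.tail_cons, ← derivative]
      constructor
      · rintro ⟨u, v, hu, hv, rfl⟩
        exact ⟨b :: u, v, hu, hv, rfl⟩
      · rintro ⟨u, v, hu, hv, h⟩
        cases u with
        | nil => exact (nil_notMem_lang mc s hu).elim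
        | cons b' u =>
          simp only [List.cons_append, List.cons.injEq] at h
          obtain ⟨rfl, rfl⟩ := h
          exact ⟨u, v, hu, hv, rfl⟩

theorem foldl_next_tok0_eq_nil (mc : Bool) (w : List Bool) :
    w.foldl (next mc) [tok0 false] = [] ↔
      ∃ φ : EMinc ℕ, (mc = true → φ.IsMinc) ∧ φ.encode = w := by
  rw [foldl_next_eq_nil, langL_singleton]
  rfl

end PSym

/-! ### Fresh proposition symbols naming formulae -/

open Computability

/-- A renaming of the proposition symbols that leaves room for new ones. -/
noncomputable def oddSymbol (n : ℕ) : ℕ :=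
  (exists_encodeNat (true :: encodeNat n)
    (by rw [List.getLastD_cons]; exact encodeNat_getLastD n)).choose

theorem encodeNat_oddSymbol (n : ℕ) : encodeNat (oddSymbol n) = true :: encodeNat n :=
  (exists_encodeNat (true :: encodeNat n)
    (by rw [List.getLastD_cons]; exact encodeNat_getLastD n)).choose_spec

/-- A proposition symbol naming the formula `χ`. -/
noncomputable def nameSymbol (χ : ML ℕ) : ℕ :=
  (exists_encodeNat (false :: (χ.encode ++ [true])) (by simp [List.getLastD])).choose

/-- The first digit separates names from every `oddSymbol`; the final `true` makes the word end as
the code of a number must; the code of χ in between lets a name be written down bit by bit. -/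
theorem encodeNat_nameSymbol (χ : ML ℕ) :
    encodeNat (nameSymbol χ) = false :: (χ.encode ++ [true]) :=
  (exists_encodeNat (false :: (χ.encode ++ [true])) (by simp [List.getLastD])).choose_spec

theorem oddSymbol_injective : oddSymbol.Injective := fun m n h => by
  have := congrArg encodeNat h
  simp only [encodeNat_oddSymbol, List.cons.injEq, true_and] at this
  exact encodeNat_injective this

theorem nameSymbol_injective : nameSymbol.Injective := fun φ ψ h => by
  have := congrArg encodeNat h
  simp only [encodeNat_nameSymbol, List.cons.injEq, true_and, List.append_cancel_right_eq] at this
  exact ML.encode_injective this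

theorem oddSymbol_ne_nameSymbol (n : ℕ) (χ : ML ℕ) : oddSymbol n ≠ nameSymbol χ := fun h => by
  have := congrArg encodeNat h
  simp [encodeNat_oddSymbol, encodeNat_nameSymbol] at this

/-- Marking every bit, as in `delimit`. -/
def mark (l : List Bool) : List Bool := l.flatMap fun b => [true, b]

theorem encodeIndex_nameSymbol (χ : ML ℕ) :
    encodeIndex (nameSymbol χ) = [true, false] ++ mark χ.encode ++ [true, true, false] := by
  rw [encodeIndex_eq, encodeNat_nameSymbol]
  simp [delimit, mark]

/-! ### The translation as a right-to-left pass over labelled bits -/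

namespace PSym

/-- The symbols of the automaton paired with the bits they read. -/
def trace (mc : Bool) : List PSym → List Bool → List (PSym × Bool)
  | _, [] => []
  | st, b :: w => (st.headD dead, b) :: trace mc (next mc st b) w

theorem map_snd_trace (mc : Bool) (st : List PSym) (w : List Bool) :
    (trace mc st w).map Prod.snd = w := by
  induction w generalizing st with
  | nil => rfl
  | cons b w ih => rw [trace, List.map_cons, ih]

theorem length_trace (mc : Bool) (st : List PSym) (w : List Bool) :
    (trace mc st w).length = w.length := by
  rw [← List.length_map Prod.snd, map_snd_trace]

/-- The symbols in the interior of a parameter. -/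
def inner : PSym → Bool
  | tok0 r => r
  | tok1 r _ => r
  | tok2 r _ _ => r
  | idx r _ => r
  | idx1 r => r
  | _ => false

/-- The part of the code of a formula with renamed symbols. -/
def posBits : PSym × Bool → List Bool
  -- The two extra bits are the marked digit `true` that `oddSymbol` puts in front of an index.
  | (tok2 _ false false, c) => [c, true, true]
  | (_, b) => [b]

/-- The part of the code of a negated formula with renamed symbols. -/
def negBits : PSym × Bool → List Bool
  -- The tokens of dual connectives, and of the two literals, differ in the third bit only.
  | (tok2 _ false false, c) => [!c, true, true]
  | (tok2 _ _ _, c) => [!c]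
  | (_, b) => [b]

/-- The part of the name of a parameter. -/
def nameBits : PSym × Bool → List Bool
  | (_, b) => [true, b]

/-- The code of a contradiction. -/
def botBits : List Bool := (ML.bot 0).encode

/-- The part of the code of `EMinc.corrupt`, outside of parameters. -/
def corruptBits : PSym × Bool → List Bool
  -- A literal and the end of an inclusion atom give a contradiction, the connectives give `or` and
  -- the modalities `dia`. Whole tokens are produced at their third bit, so all other bits give
  -- nothing.
  | (tok2 _ false false, _) => botBits
  | (tok2 _ false true, _) => [false, true, true]
  | (tok2 _ true false, _) => [true, false, false]
  | (pairs, false) => botBits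
  | _ => []

/-- What a parameter contributes to `EMinc.corrupt`. -/
def corruptPar (l : List (PSym × Bool)) : List Bool :=
  -- The tokens `or`, `or`, `and`, `prop` and the first marked digit of the name. Below, `[true,
  -- true, false]` ends a name, and the eight bits are `and`, `nprop` and again the first digit.
  [false, true, true, false, true, true, false, true, false, false, false, false, true, false] ++
    (l.flatMap nameBits ++ ([true, true, false] ++ (l.flatMap negBits ++
    ([false, true, false, false, false, true, true, false] ++
    (l.flatMap nameBits ++ ([true, true, false] ++ l.flatMap posBits))))))

/-- What a parameter contributes to `EMinc.flatten`. -/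
def flattenPar (l : List (PSym × Bool)) : List Bool :=
  [false, false, false, true, false] ++ (l.flatMap nameBits ++ [true, true, false])

/-- One step of the translation, which works from right to left. Its state consists of the part of
the current parameter read so far and of the two words produced so far. -/
def translateStep (e : PSym × Bool) (x : List (PSym × Bool) × List Bool × List Bool) :
    List (PSym × Bool) × List Bool × List Bool :=
  -- `par` reads the first bit of a parameter, so from the right it is met last, when the buffer
  -- holds the rest of that parameter.
  if e.1 = par then ([], corruptPar (e :: x.1) ++ x.2.1, flattenPar (e :: x.1) ++ x.2.2)
  else if e.1.inner then (e :: x.1, x.2.1, x.2.2)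
  else (x.1, corruptBits e ++ x.2.1, posBits e ++ x.2.2)

/-- The translation of a sequence of symbols and bits. -/
def translate (l : List (PSym × Bool)) : List (PSym × Bool) × List Bool × List Bool :=
  l.foldr translateStep ([], [], [])

theorem trace_delimit (mc r ok : Bool) (l : List Bool) (hl : l.getLastD ok = true)
    (st : List PSym) (v : List Bool) :
    ∃ X, trace mc (idx r ok :: st) (delimit l ++ v) = X ++ trace mc st v ∧
      (∀ e ∈ X, e.1 ≠ par ∧ e.1.inner = r ∧ posBits e = [e.2] ∧ negBits e = [e.2] ∧
        corruptBits e = []) ∧ X.map Prod.snd = delimit l := by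
  induction l generalizing ok with
  | nil =>
    cases hl
    exact ⟨[(idx r true, false)], rfl, by simp [inner, posBits, negBits, corruptBits], rfl⟩
  | cons b l ih =>
    obtain ⟨X, h1, h2, h3⟩ := ih b (by rw [List.getLastD_cons] at hl; exact hl)
    refine ⟨(idx r ok, true) :: (idx1 r, b) :: X, ?_, ?_, by simp [h3]⟩
    · simp only [delimit_cons, List.cons_append, trace, next, step, List.headD_cons,
        List.tail_cons, List.nil_append, h1]
    · simp only [List.forall_mem_cons]
      exact ⟨by simp [inner, posBits, negBits, corruptBits],
        by simp [inner, posBits, negBits, corruptBits], h2⟩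

theorem flatMap_eq_map_snd {X : List (PSym × Bool)} {f : PSym × Bool → List Bool}
    (h : ∀ e ∈ X, f e = [e.2]) : X.flatMap f = X.map Prod.snd := by
  induction X with
  | nil => rfl
  | cons e X ih =>
    rw [List.forall_mem_cons] at h
    rw [List.flatMap_cons, h.1, ih h.2]; rfl

/-- While a parameter is read, the stack below it is untouched and all symbols are `inner`, so a
pass from the right can buffer it. The start is `tok0 true` and not `par`, for the sake of the
subformulae in the induction. -/
theorem trace_encode (χ : ML ℕ) (st : List PSym) (v : List Bool) :
    ∃ X, trace false (tok0 true :: st) (χ.encode ++ v) = X ++ trace false st v ∧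
      (∀ e ∈ X, e.1 ≠ par ∧ e.1.inner = true) ∧
      X.flatMap posBits = (χ.map oddSymbol).encode ∧
      X.flatMap negBits = (χ.map oddSymbol).neg.encode ∧ X.map Prod.snd = χ.encode := by
  induction χ generalizing st v with
  | prop p =>
    obtain ⟨X, h1, h2, h3⟩ := trace_delimit false true true _ (encodeNat_getLastD p) st v
    refine ⟨(tok0 true, false) :: (tok1 true false, false) :: (tok2 true false false, false) :: X,
      ?_, ?_, ?_, ?_, ?_⟩
    · simp [ML.encode, trace, next, step, encodeIndex_eq, h1]
    · simp only [List.forall_mem_cons]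
      exact ⟨by simp [inner], by simp [inner], by simp [inner],
        fun e he => ⟨(h2 e he).1, (h2 e he).2.1⟩⟩
    · simp [posBits, flatMap_eq_map_snd fun e he => (h2 e he).2.2.1, h3, ML.encode, ML.map,
        encodeIndex_eq, encodeNat_oddSymbol]
    · simp [negBits, flatMap_eq_map_snd fun e he => (h2 e he).2.2.2.1, h3, ML.encode, ML.map,
        ML.neg, encodeIndex_eq, encodeNat_oddSymbol]
    · simp [h3, ML.encode, encodeIndex_eq]
  | nprop p =>
    obtain ⟨X, h1, h2, h3⟩ := trace_delimit false true true _ (encodeNat_getLastD p) st v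
    refine ⟨(tok0 true, false) :: (tok1 true false, false) :: (tok2 true false false, true) :: X,
      ?_, ?_, ?_, ?_, ?_⟩
    · simp [ML.encode, trace, next, step, encodeIndex_eq, h1]
    · simp only [List.forall_mem_cons]
      exact ⟨by simp [inner], by simp [inner], by simp [inner],
        fun e he => ⟨(h2 e he).1, (h2 e he).2.1⟩⟩
    · simp [posBits, flatMap_eq_map_snd fun e he => (h2 e he).2.2.1, h3, ML.encode, ML.map,
        encodeIndex_eq, encodeNat_oddSymbol]
    · simp [negBits, flatMap_eq_map_snd fun e he => (h2 e he).2.2.2.1, h3, ML.encode, ML.map,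
        ML.neg, encodeIndex_eq, encodeNat_oddSymbol]
    · simp [h3, ML.encode, encodeIndex_eq]
  | and φ ψ ih ih' =>
    obtain ⟨Y, k1, k2, k3, k4, k5⟩ := ih' st v
    obtain ⟨X, h1, h2, h3, h4, h5⟩ := ih (tok0 true :: st) (ψ.encode ++ v)
    refine ⟨(tok0 true, false) :: (tok1 true false, true) :: (tok2 true false true, false) ::
      (X ++ Y), ?_, ?_, ?_, ?_, ?_⟩
    · simp [ML.encode, trace, next, step, h1, k1]
    · simp only [List.forall_mem_cons, List.forall_mem_append]
      exact ⟨by simp [inner], by simp [inner], by simp [inner], h2, k2⟩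
    · simp [posBits, h3, k3, ML.encode, ML.map]
    · simp [negBits, h4, k4, ML.encode, ML.map, ML.neg]
    · simp [h5, k5, ML.encode]
  | or φ ψ ih ih' =>
    obtain ⟨Y, k1, k2, k3, k4, k5⟩ := ih' st v
    obtain ⟨X, h1, h2, h3, h4, h5⟩ := ih (tok0 true :: st) (ψ.encode ++ v)
    refine ⟨(tok0 true, false) :: (tok1 true false, true) :: (tok2 true false true, true) ::
      (X ++ Y), ?_, ?_, ?_, ?_, ?_⟩
    · simp [ML.encode, trace, next, step, h1, k1]
    · simp only [List.forall_mem_cons, List.forall_mem_append]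
      exact ⟨by simp [inner], by simp [inner], by simp [inner], h2, k2⟩
    · simp [posBits, h3, k3, ML.encode, ML.map]
    · simp [negBits, h4, k4, ML.encode, ML.map, ML.neg]
    · simp [h5, k5, ML.encode]
  | dia φ ih =>
    obtain ⟨X, h1, h2, h3, h4, h5⟩ := ih st v
    refine ⟨(tok0 true, true) :: (tok1 true true, false) :: (tok2 true true false, false) :: X,
      ?_, ?_, ?_, ?_, ?_⟩
    · simp [ML.encode, trace, next, step, h1]
    · simp only [List.forall_mem_cons]
      exact ⟨by simp [inner], by simp [inner], by simp [inner], h2⟩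
    · simp [posBits, h3, ML.encode, ML.map]
    · simp [negBits, h4, ML.encode, ML.map, ML.neg]
    · simp [h5, ML.encode]
  | box φ ih =>
    obtain ⟨X, h1, h2, h3, h4, h5⟩ := ih st v
    refine ⟨(tok0 true, true) :: (tok1 true true, false) :: (tok2 true true false, true) :: X,
      ?_, ?_, ?_, ?_, ?_⟩
    · simp [ML.encode, trace, next, step, h1]
    · simp only [List.forall_mem_cons]
      exact ⟨by simp [inner], by simp [inner], by simp [inner], h2⟩
    · simp [posBits, h3, ML.encode, ML.map]
    · simp [negBits, h4, ML.encode, ML.map, ML.neg]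
    · simp [h5, ML.encode]

theorem translate_inner {X : List (PSym × Bool)} (hX : ∀ e ∈ X, e.1 ≠ par ∧ e.1.inner = true)
    {Y : List (PSym × Bool)} {W T : List Bool} (h : translate Y = ([], W, T)) :
    translate (X ++ Y) = (X, W, T) := by
  induction X with
  | nil => exact h
  | cons e X ih =>
    rw [List.forall_mem_cons] at hX
    have := ih hX.2
    rw [translate] at this
    rw [translate, List.cons_append, List.foldr_cons, this, translateStep]
    simp [hX.1]

theorem translate_outer {X : List (PSym × Bool)} (hX : ∀ e ∈ X, e.1 ≠ par ∧ e.1.inner = false)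
    {Y : List (PSym × Bool)} {W T : List Bool} (h : translate Y = ([], W, T)) :
    translate (X ++ Y) = ([], X.flatMap corruptBits ++ W, X.flatMap posBits ++ T) := by
  induction X with
  | nil => exact h
  | cons e X ih =>
    rw [List.forall_mem_cons] at hX
    have := ih hX.2
    rw [translate] at this
    rw [translate, List.cons_append, List.foldr_cons, this, translateStep]
    simp [hX.1]

theorem translate_par (χ : ML ℕ) (st : List PSym) (v : List Bool) {W T : List Bool}
    (h : translate (trace false st v) = ([], W, T)) :
    translate (trace false (par :: st) (χ.encode ++ v)) =
      ([], [false, true, true] ++ (EMinc.mismatch oddSymbol nameSymbol χ).encode ++ W,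
        (ML.prop (nameSymbol χ)).encode ++ T) := by
  obtain ⟨X, h1, h2, h3, h4, h5⟩ := trace_encode χ st v
  cases hχ : χ.encode with
  | nil => cases χ <;> simp [ML.encode] at hχ
  | cons b w =>
    rw [hχ] at h1 h5
    cases X with
    | nil => simp at h5
    | cons e X =>
      obtain ⟨s, b'⟩ := e
      simp only [List.cons_append, trace, List.cons.injEq, Prod.mk.injEq] at h1
      obtain ⟨⟨rfl, rfl⟩, h1⟩ := h1
      rw [List.forall_mem_cons] at h2
      -- `par` and `tok0 true` make the same move, so the two traces differ in their first symbol
      -- only.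
      have h1' : trace false (next false (par :: st) b) (w ++ v) = X ++ trace false st v := h1
      have ht := translate_inner h2.2 h
      rw [translate] at ht
      rw [List.cons_append, trace, h1', translate, List.foldr_cons, ht, translateStep,
        if_pos (by rfl)]
      have e1 : ((par, b) :: X).flatMap posBits = (χ.map oddSymbol).encode := h3
      have e2 : ((par, b) :: X).flatMap negBits = (χ.map oddSymbol).neg.encode := h4
      have e3 : ((par, b) :: X).flatMap nameBits = mark χ.encode := by
        rw [mark, hχ, ← h5, List.flatMap_map]
        rfl
      simp only [List.headD_cons, corruptPar, flattenPar, e1, e2, e3, EMinc.mismatch, ML.encode,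
        encodeIndex_nameSymbol]
      simp

theorem translate_pairs (ps : List (ML ℕ × ML ℕ)) (st : List PSym) (v : List Bool)
    {W T : List Bool} (h : translate (trace false st v) = ([], W, T)) :
    translate (trace false (pairs :: st) (encodePairs ps ++ v)) =
      ([], (EMinc.corrupt oddSymbol nameSymbol 0 (.inc ps)).encode ++ W,
        encodePairs (ps.map fun c => (.prop (nameSymbol c.1), .prop (nameSymbol c.2))) ++ T) := by
  induction ps with
  | nil =>
    have := translate_outer (X := [(pairs, false)]) (by simp [inner]) h
    simpa [corruptBits, posBits, botBits, EMinc.corrupt, trace, next, step] using this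
  | cons c ps ih =>
    have := translate_outer (X := [(pairs, true)]) (by simp [inner])
      (translate_par c.1 _ _ (translate_par c.2 _ _ ih))
    simp only [encodePairs_cons, List.cons_append, List.append_assoc, List.map_cons, trace]
    refine this.trans ?_
    simp [corruptBits, posBits, EMinc.corrupt, ML.encode]

theorem translate_token (a b c : Bool) (st : List PSym) {v W T : List Bool}
    (h : translate (trace false (step false (tok2 false a b) c ++ st) v) = ([], W, T)) :
    translate (trace false (tok0 false :: st) (a :: b :: c :: v)) =
      ([], corruptBits (tok2 false a b, c) ++ W, a :: b :: (posBits (tok2 false a b, c) ++ T)) := by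
  have := translate_outer
    (X := [(tok0 false, a), (tok1 false a, b), (tok2 false a b, c)]) (by simp [inner]) h
  simpa [corruptBits, posBits, trace, next, step] using this

theorem translate_atom (p : ℕ) (c : Bool) (st : List PSym) (v : List Bool) {W T : List Bool}
    (h : translate (trace false st v) = ([], W, T)) :
    translate (trace false (tok0 false :: st) (false :: false :: c :: (encodeIndex p ++ v))) =
      ([], botBits ++ W, false :: false :: c :: (encodeIndex (oddSymbol p) ++ T)) := by
  obtain ⟨X, h1, h2, h3⟩ := trace_delimit false false true _ (encodeNat_getLastD p) st v
  have := translate_outer (fun e he => ⟨(h2 e he).1, (h2 e he).2.1⟩) h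
  rw [← h1] at this
  refine (translate_token false false c _ this).trans ?_
  have hc : X.flatMap corruptBits = [] :=
    List.flatMap_eq_nil_iff.2 fun e he => (h2 e he).2.2.2.2
  simp [corruptBits, posBits, hc, flatMap_eq_map_snd fun e he => (h2 e he).2.2.1, h3,
    encodeIndex_eq, encodeNat_oddSymbol]

/-- In prefix notation the arguments lie to the right of their connective, so they have been
translated when its token is met, and prepending a few bits to both outputs is enough. The general
`st` and `v` serve the first of two arguments. -/
theorem translate_encode (φ : EMinc ℕ) (st : List PSym) (v : List Bool) {W T : List Bool}
    (h : translate (trace false st v) = ([], W, T)) :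
    translate (trace false (tok0 false :: st) (φ.encode ++ v)) =
      ([], (φ.corrupt oddSymbol nameSymbol 0).encode ++ W,
        (φ.flatten oddSymbol nameSymbol).encode ++ T) := by
  induction φ generalizing st v W T with
  | prop p =>
    simpa [EMinc.encode, EMinc.corrupt, EMinc.flatten, botBits] using translate_atom p false st v h
  | nprop p =>
    simpa [EMinc.encode, EMinc.corrupt, EMinc.flatten, botBits] using translate_atom p true st v h
  | and φ ψ ih ih' =>
    have := translate_token false true false st (ih (tok0 false :: st) _ (ih' st v h))
    simpa [EMinc.encode, EMinc.corrupt, EMinc.flatten, ML.encode, corruptBits, posBits] using this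
  | or φ ψ ih ih' =>
    have := translate_token false true true st (ih (tok0 false :: st) _ (ih' st v h))
    simpa [EMinc.encode, EMinc.corrupt, EMinc.flatten, ML.encode, corruptBits, posBits] using this
  | dia φ ih =>
    have := translate_token true false false st (ih st _ h)
    simpa [EMinc.encode, EMinc.corrupt, EMinc.flatten, ML.encode, corruptBits, posBits] using this
  | box φ ih =>
    have := translate_token true false true st (ih st _ h)
    simpa [EMinc.encode, EMinc.corrupt, EMinc.flatten, ML.encode, corruptBits, posBits] using this
  | inc ps =>
    have := translate_token true true false st (translate_pairs ps st v h)
    simpa [EMinc.flatten, corruptBits, posBits] using this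

/-! ### The two reductions as functions on words -/

/-- The sequence of symbols and bits, if the word is the code of a formula. -/
def parse (mc : Bool) (x : List Bool) : List (PSym × Bool) :=
  if x.foldl (next mc) [tok0 false] = [] then trace mc [tok0 false] x else []

/-- The reduction of `valMinc` to `valEMinc`. -/
def restrict (x : List Bool) : List Bool := (parse true x).map Prod.snd

/-- The reduction of `valEMinc` to `valMinc`. -/
def reduce (x : List Bool) : List Bool :=
  let y := translate (parse false x)
  [false, true, true] ++ (y.2.1 ++ y.2.2)

/-- On codes of `Minc` formulae `restrict` is the identity, and unique readability makes membership
in `Minc` a property of the word. Every other word goes to the empty word, which is not a code. -/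
theorem mem_valMinc_iff (s : TeamSemantics) (x : List Bool) :
    x ∈ valMinc.{u} s ↔ restrict x ∈ valEMinc.{u} s := by
  by_cases h : x.foldl (next true) [tok0 false] = []
  · rw [restrict, parse, if_pos h, map_snd_trace]
    obtain ⟨φ, hφ, rfl⟩ := (foldl_next_tok0_eq_nil true x).1 h
    constructor
    · rintro ⟨ψ, _, h1, h2⟩
      exact ⟨ψ, h1, h2⟩
    · rintro ⟨ψ, h1, h2⟩
      exact ⟨ψ, EMinc.encode_injective h2 ▸ hφ rfl, h1, h2⟩
  · rw [restrict, parse, if_neg h]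
    constructor
    · rintro ⟨ψ, h1, _, h2⟩
      exact (h ((foldl_next_tok0_eq_nil true x).2 ⟨ψ, fun _ => h1, h2⟩)).elim
    · rintro ⟨ψ, _, h2⟩
      exact (nil_notMem_code false false ⟨ψ, by simp, h2⟩).elim

theorem mem_valEMinc_iff (s : TeamSemantics) (x : List Bool) :
    x ∈ valEMinc.{u} s ↔ reduce x ∈ valMinc.{u} s := by
  by_cases h : x.foldl (next false) [tok0 false] = []
  · obtain ⟨φ, -, rfl⟩ := (foldl_next_tok0_eq_nil false x).1 h
    have h1 := translate_encode φ [] [] (W := []) (T := []) rfl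
    have h2 : reduce φ.encode = (φ.toMinc oddSymbol nameSymbol 0).encode := by
      simp only [List.append_nil] at h1
      rw [reduce, parse, if_pos h, h1]
      simp [EMinc.toMinc, EMinc.encode, ML.encode_toEMinc]
    have h3 := EMinc.valid_toMinc_iff.{u} oddSymbol nameSymbol 0 s oddSymbol_injective
      nameSymbol_injective oddSymbol_ne_nameSymbol φ
    rw [h2]
    constructor
    · rintro ⟨ψ, h4, h5⟩
      rw [EMinc.encode_injective h5] at h4
      exact ⟨_, EMinc.isMinc_toMinc _ _ _ φ, h3.2 h4, rfl⟩
    · rintro ⟨ψ, _, h4, h5⟩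
      rw [EMinc.encode_injective h5] at h4
      exact ⟨φ, h3.1 h4, rfl⟩
  -- A word that is not a code becomes the token `or` without arguments, which is not a code either.
  · have h2 : reduce x = [false, true, true] := by
      rw [reduce, parse, if_neg h]; rfl
    rw [h2]
    constructor
    · rintro ⟨ψ, _, h2⟩
      exact (h ((foldl_next_tok0_eq_nil false x).2 ⟨ψ, by simp, h2⟩)).elim
    · rintro ⟨ψ, -, -, h2⟩
      cases ψ <;> simp [EMinc.encode] at h2
      rename_i φ ψ
      exact (nil_notMem_code false false ⟨φ, by simp, h2.1⟩).elim

end PSym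

/-! ### Rules for executing stack programs -/

namespace Prog

open Function

section

variable {K : Type} [DecidableEq K] {Γ : K → Type}

theorem Exec.mono {P : Prog Γ} {s s' : Store Γ} {m n : ℕ} (h : Exec P s s' m) (hmn : m ≤ n) :
    Exec P s s' n := by
  cases h with
  | skip => exact .skip _ _
  | push s k a m =>
    obtain ⟨n, rfl⟩ : ∃ n', n = n' + 1 := ⟨n - 1, by omega⟩
    exact .push _ _ _ _
  | seq h h' ht => exact .seq h h' (ht.trans hmn)
  | case h ht => exact .case h (ht.trans hmn)
  | loop_nil m h =>
    obtain ⟨n, rfl⟩ : ∃ n', n = n' + 1 := ⟨n - 1, by omega⟩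
    exact .loop_nil _ h
  | loop_cons h h' h'' ht => exact .loop_cons h h' h'' (ht.trans hmn)

/-- Each elementary step pushes at most one symbol. This bounds the later loops that run over stacks
filled by earlier ones. -/
theorem Exec.length_le {P : Prog Γ} {s s' : Store Γ} {n : ℕ} (h : Exec P s s' n) (k : K) :
    (s' k).length ≤ (s k).length + n := by
  induction h with
  | skip => omega
  | push s k' a n =>
    by_cases hk : k = k'
    · subst hk; simp
    · simp [hk]
  | seq _ _ ht ih ih' => omega
  | @case k' P s s' n t _ ht ih =>
    by_cases hk : k = k'
    · subst hk; simp at ih; omega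
    · simp [hk] at ih; omega
  | loop_nil => omega
  | @loop_cons k' P s s' s'' a l m n t hs _ _ ht ih ih' =>
    by_cases hk : k = k'
    · subst hk; simp at ih; simp [hs]; omega
    · simp [hk] at ih; omega

/-- Sequential composition of a list of programs. -/
def seqs : List (Prog Γ) → Prog Γ
  | [] => .skip
  | P :: Ps => .seq P (seqs Ps)

/-- Pushing a word. -/
def pushes (k : K) : List (Γ k) → Prog Γ
  | [] => .skip
  | a :: l => .seq (pushes k l) (.push k a)

theorem exec_pushes (k : K) (l : List (Γ k)) (s : Store Γ) :
    Exec (pushes k l) s (update s k (l ++ s k)) l.length := by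
  induction l with
  | nil => simpa [pushes] using Exec.skip s 0
  | cons a l ih =>
    refine .seq (n := 1) ih ?_ (by simp)
    simpa using Exec.push (update s k (l ++ s k)) k a 0

/-- The loop rule: `F x l` is the store in which `l` remains on the stack `k`, and `Inv` is an
invariant. -/
theorem exec_loop {α : Type} {k : K} {P : Γ k → Prog Γ} (F : α → List (Γ k) → Store Γ)
    (g : α → Γ k → α) (Inv : α → List (Γ k) → Prop) (t : ℕ)
    (hF : ∀ x l, F x l k = l) (hF' : ∀ x l l', update (F x l) k l' = F x l')
    (hI : ∀ x a l, Inv x (a :: l) → Inv (g x a) l)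
    (h : ∀ x a l, Inv x (a :: l) → Exec (P a) (F x l) (F (g x a) l) t)
    (x : α) (l : List (Γ k)) (hx : Inv x l) :
    Exec (.loop k P) (F x l) (F (l.foldl g x) []) (l.length * (t + 1) + 1) := by
  induction l generalizing x with
  | nil => exact .loop_nil _ (hF _ _)
  | cons a l ih =>
    refine .loop_cons (hF _ _) ?_ (ih _ (hI _ _ _ hx)) (m := t) ?_
    · rw [hF']; exact h x a l hx
    · simp only [List.length_cons, Nat.succ_mul]; omega

theorem exec_clear (k : K) (s : Store Γ) :
    Exec (.loop k fun _ => .skip) s (update s k []) ((s k).length + 1) := by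
  have := exec_loop (k := k) (P := fun _ => .skip) (fun (_ : Unit) l => update s k l)
    (fun x _ => x) (fun _ _ => True) 0 (by simp) (by simp) (fun _ _ _ _ => trivial)
    (fun x a l _ => .skip _ _) () (s k) trivial
  simpa using this

theorem foldl_append_eq {α β : Type} (h : α → List β) (l : List α) (x : List β) :
    l.foldl (fun x a => h a ++ x) x = l.reverse.flatMap h ++ x := by
  induction l generalizing x with
  | nil => rfl
  | cons a l ih => simp [ih]

/-- Moving the contents of a stack to two other ones, which reverses and encodes them. -/
theorem exec_move₂ {k k' k'' : K} (hk : k ≠ k') (hk' : k ≠ k'') (hk'' : k' ≠ k'')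
    (h : Γ k → List (Γ k')) (h' : Γ k → List (Γ k'')) (c : ℕ)
    (hc : ∀ a, (h a).length + (h' a).length ≤ c) (s : Store Γ) :
    Exec (.loop k fun a => .seq (pushes k' (h a)) (pushes k'' (h' a))) s
      (update (update (update s k []) k' ((s k).reverse.flatMap h ++ s k'))
        k'' ((s k).reverse.flatMap h' ++ s k''))
      ((s k).length * (c + 1) + 1) := by
  have := exec_loop (k := k) (P := fun a => .seq (pushes k' (h a)) (pushes k'' (h' a)))
    (fun (x : List (Γ k') × List (Γ k'')) l => update (update (update s k l) k' x.1) k'' x.2)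
    (fun x a => (h a ++ x.1, h' a ++ x.2)) (fun _ _ => True) c (by simp [hk, hk'])
    (by
      intro x l l'
      rw [update_comm hk'.symm, update_comm hk.symm, update_idem])
    (fun _ _ _ _ => trivial)
    (fun x a l _ => by
      refine .seq (exec_pushes k' (h a) _) ?_ (hc a)
      convert exec_pushes k'' (h' a) _ using 1
      rw [update_of_ne hk''.symm, update_self, update_of_ne hk'', update_self,
        update_comm hk''.symm, update_idem, update_idem])
    (s k', s k'') (s k) trivial
  have hfold : ∀ (l : List (Γ k)) x, l.foldl (fun (x : List (Γ k') × List (Γ k'')) a =>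
      (h a ++ x.1, h' a ++ x.2)) x = (l.reverse.flatMap h ++ x.1, l.reverse.flatMap h' ++ x.2) := by
    intro l
    induction l with
    | nil => exact fun _ => rfl
    | cons a l ih => intro x; simp [ih]
  rw [hfold] at this
  simpa using this

/-- Moving the contents of a stack to another one, which reverses and encodes them. -/
theorem exec_move {k k' : K} (hk : k ≠ k') (h : Γ k → List (Γ k')) (c : ℕ)
    (hc : ∀ a, (h a).length ≤ c) (s : Store Γ) :
    Exec (.loop k fun a => pushes k' (h a)) s
      (update (update s k []) k' ((s k).reverse.flatMap h ++ s k'))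
      ((s k).length * (c + 1) + 1) := by
  have := exec_loop (k := k) (P := fun a => pushes k' (h a))
    (fun x l => update (update s k l) k' x) (fun x a => h a ++ x) (fun _ _ => True) c
    (by simp [hk]) (by intro x l l'; rw [update_comm hk.symm, update_idem])
    (fun _ _ _ _ => trivial)
    (fun x a l _ => by simpa using (exec_pushes k' (h a) (update (update s k l) k' x)).mono (hc a))
    (s k') (s k) trivial
  rw [foldl_append_eq] at this
  simpa using this

end

/-- The stacks used by the reductions. -/
inductive Stk : Type
  | inp | bits | pda | tr | buf | buf' | corr | flat
  deriving DecidableEq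

instance : Fintype Stk :=
  ⟨{.inp, .bits, .pda, .tr, .buf, .buf', .corr, .flat}, fun k => by cases k <;> decide⟩

/-- The alphabets of the stacks. -/
@[reducible] def Stk.Γ : Stk → Type
  | .inp => Bool
  | .bits => Bool
  | .pda => PSym
  | .tr => PSym × Bool
  | .buf => PSym × Bool
  | .buf' => PSym × Bool
  | .corr => Bool
  | .flat => Bool

instance : ∀ k, Fintype (Stk.Γ k)
  | .inp => inferInstanceAs (Fintype Bool)
  | .bits => inferInstanceAs (Fintype Bool)
  | .pda => inferInstanceAs (Fintype PSym)
  | .tr => inferInstanceAs (Fintype (PSym × Bool))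
  | .buf => inferInstanceAs (Fintype (PSym × Bool))
  | .buf' => inferInstanceAs (Fintype (PSym × Bool))
  | .corr => inferInstanceAs (Fintype Bool)
  | .flat => inferInstanceAs (Fintype Bool)

/-- The store with the given contents of the stacks. -/
def sto (i x : List Bool) (p : List PSym) (y a a' : List (PSym × Bool)) (w t : List Bool) :
    Store Stk.Γ
  | .inp => i
  | .bits => x
  | .pda => p
  | .tr => y
  | .buf => a
  | .buf' => a'
  | .corr => w
  | .flat => t

section

variable (i x : List Bool) (p : List PSym) (y a a' : List (PSym × Bool)) (w t : List Bool)

theorem update_inp (l : List Bool) :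
    update (sto i x p y a a' w t) Stk.inp l = sto l x p y a a' w t := by
  funext k; cases k <;> rfl
theorem update_bits (l : List Bool) :
    update (sto i x p y a a' w t) Stk.bits l = sto i l p y a a' w t := by
  funext k; cases k <;> rfl
theorem update_pda (l : List PSym) :
    update (sto i x p y a a' w t) Stk.pda l = sto i x l y a a' w t := by
  funext k; cases k <;> rfl
theorem update_tr (l : List (PSym × Bool)) :
    update (sto i x p y a a' w t) Stk.tr l = sto i x p l a a' w t := by
  funext k; cases k <;> rfl
theorem update_buf (l : List (PSym × Bool)) :
    update (sto i x p y a a' w t) Stk.buf l = sto i x p y l a' w t := by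
  funext k; cases k <;> rfl
theorem update_buf' (l : List (PSym × Bool)) :
    update (sto i x p y a a' w t) Stk.buf' l = sto i x p y a l w t := by
  funext k; cases k <;> rfl
theorem update_corr (l : List Bool) :
    update (sto i x p y a a' w t) Stk.corr l = sto i x p y a a' l t := by
  funext k; cases k <;> rfl
theorem update_flat (l : List Bool) :
    update (sto i x p y a a' w t) Stk.flat l = sto i x p y a a' w l := by
  funext k; cases k <;> rfl

theorem sto_nil : sto [] [] [] [] [] [] [] [] = fun _ => [] := by
  funext k; cases k <;> rfl

end

end Prog

/-! ### Stack programs for the two reductions -/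

namespace Prog

open Function PSym

/-- The parser: the input, in reverse, is on the stack `inp`; the result is produced on `tr`. -/
def parser (mc : Bool) : Prog Stk.Γ := seqs [
  loop .inp fun b => pushes .bits [b],
  push .pda (tok0 false),
  loop .bits fun b => case .pda fun o =>
    seq (pushes .pda (step mc (o.getD dead) b)) (push .tr (o.getD dead, b)),
  -- The automaton accepts by empty stack. Otherwise both its stack and the trace are erased, in
  -- accordance with `parse`.
  case .pda fun o => match o with
    | none => skip
    | some _ => seq (loop .pda fun _ => skip) (loop .tr fun _ => skip)]

theorem length_step_le (mc : Bool) (s : PSym) (b : Bool) : (step mc s b).length ≤ 3 := by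
  revert mc s b; decide

theorem exec_parser (mc : Bool) (x : List Bool) :
    Exec (parser mc) (sto x.reverse [] [] [] [] [] [] [])
      (sto [] [] [] (parse mc x).reverse [] [] [] []) (15 * x.length + 9) := by
  have e1 : Exec (loop .inp fun b => pushes .bits [b]) (sto x.reverse [] [] [] [] [] [] [])
      (sto [] x [] [] [] [] [] []) (x.length * 2 + 1) := by
    have := exec_move (k := Stk.inp) (k' := Stk.bits) (by decide) (fun b => [b]) 1 (by simp)
      (sto x.reverse [] [] [] [] [] [] [])
    simpa [update_inp, update_bits, sto] using this
  have e2 : Exec (push .pda (tok0 false)) (sto [] x [] [] [] [] [] [])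
      (sto [] x [tok0 false] [] [] [] [] []) 1 := by
    have := Exec.push (sto [] x [] [] [] [] [] []) Stk.pda (tok0 false) 0
    simpa [update_pda, sto] using this
  have e3 : Exec (loop .bits fun b => case .pda fun o =>
        seq (pushes .pda (step mc (o.getD dead) b)) (push .tr (o.getD dead, b)))
      (sto [] x [tok0 false] [] [] [] [] [])
      (sto [] [] (x.foldl (next mc) [tok0 false]) (trace mc [tok0 false] x).reverse [] [] [] [])
      (x.length * 6 + 1) := by
    have := exec_loop (k := Stk.bits) (P := fun b => case .pda fun o =>
        seq (pushes .pda (step mc (o.getD dead) b)) (push .tr (o.getD dead, b)))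
      (fun (y : List PSym × List (PSym × Bool)) l => sto [] l y.1 y.2 [] [] [] [])
      (fun y b => (next mc y.1 b, (y.1.headD dead, b) :: y.2)) (fun _ _ => True) 5
      (fun _ _ => rfl) (fun _ _ _ => update_bits ..) (fun _ _ _ _ => trivial) (fun y b l _ => by
        obtain ⟨st, tr⟩ := y
        refine .case (n := 4) ?_ le_rfl
        have h1 := (exec_pushes (Γ := Stk.Γ) Stk.pda (step mc (st.headD dead) b)
          (sto [] l st.tail tr [] [] [] [])).mono (length_step_le _ _ _)
        have h2 := Exec.push (sto [] l (next mc st b) tr [] [] [] []) Stk.tr (st.headD dead, b) 0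
        have h3 : st.head?.getD dead = st.headD dead := by cases st <;> rfl
        rw [update_pda] at h1
        rw [update_tr] at h2
        simp only [sto, update_pda, h3]
        exact .seq h1 h2 le_rfl)
      ([tok0 false], []) x trivial
    have hf : ∀ (x : List Bool) (st : List PSym) (tr : List (PSym × Bool)),
        x.foldl (fun (y : List PSym × List (PSym × Bool)) b =>
          (next mc y.1 b, (y.1.headD dead, b) :: y.2)) (st, tr) =
        (x.foldl (next mc) st, (trace mc st x).reverse ++ tr) := by
      intro x
      induction x with
      | nil => exact fun _ _ => rfl
      | cons b x ih => 
        intro st tr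
        rw [List.foldl_cons, ih, trace, List.reverse_cons, List.append_assoc]
        rfl
    rw [hf] at this
    simpa using this
  -- At most one symbol is pushed in each of the steps counted by `e3`, on a stack that starts with
  -- one symbol.
  have hlen : (x.foldl (next mc) [tok0 false]).length ≤ x.length * 6 + 2 := by
    have := e3.length_le Stk.pda
    simp only [sto, List.length_singleton] at this
    omega
  have e4 : Exec (case .pda fun o => match o with
        | none => skip
        | some _ => seq (loop .pda fun _ => skip) (loop .tr fun _ => skip))
      (sto [] [] (x.foldl (next mc) [tok0 false]) (trace mc [tok0 false] x).reverse [] [] [] [])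
      (sto [] [] [] (parse mc x).reverse [] [] [] []) (x.length * 7 + 5) := by
    rw [parse]
    cases hst : x.foldl (next mc) [tok0 false] with
    | nil =>
      refine .case (n := 0) ?_ (by omega)
      simp only [sto, update_pda, if_true]
      exact .skip _ _
    | cons s st =>
      rw [hst] at hlen
      refine .case (n := x.length * 7 + 4) ?_ (by omega)
      simp only [sto, update_pda, reduceCtorEq, if_false, List.head?_cons, List.tail_cons]
      have h1 := exec_clear (Γ := Stk.Γ) Stk.pda
        (sto [] [] st (trace mc [tok0 false] x).reverse [] [] [] [])
      have h2 := exec_clear (Γ := Stk.Γ) Stk.tr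
        (sto [] [] [] (trace mc [tok0 false] x).reverse [] [] [] [])
      rw [update_pda] at h1
      rw [update_tr] at h2
      refine .seq h1 h2 ?_
      simp only [sto, List.length_reverse, length_trace, List.length_cons] at hlen ⊢
      omega
  exact .seq e1 (.seq e2 (.seq e3 (.seq e4 (.skip _ 0) le_rfl) le_rfl) le_rfl) (by omega)

/-- The program for `restrict`. -/
def restricter : Prog Stk.Γ := seq (parser true) (loop .tr fun e => pushes .flat [e.2])

theorem length_parse_le (mc : Bool) (x : List Bool) : (parse mc x).length ≤ x.length := by
  rw [parse]
  split
  · rw [length_trace]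
  · simp

theorem exec_restricter (x : List Bool) :
    Exec restricter (sto x.reverse [] [] [] [] [] [] []) (sto [] [] [] [] [] [] [] (restrict x))
      (17 * x.length + 10) := by
  have := exec_move (Γ := Stk.Γ) (k := Stk.tr) (k' := Stk.flat) (by decide) (fun e => [e.2]) 1
    (by simp) (sto [] [] [] (parse true x).reverse [] [] [] [])
  rw [update_tr, update_flat] at this
  refine .seq (exec_parser true x) (s'' := sto [] [] [] [] [] [] [] (restrict x))
    (n := (parse true x).length * 2 + 1) ?_ ?_
  · simpa [sto, restrict, List.map_eq_flatMap] using this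
  · have := length_parse_le true x
    omega

/-- Copying the word on `buf'` to `k`, encoding it by `h`. -/
def emit (k : Stk) (h : PSym × Bool → List (Stk.Γ k)) : Prog Stk.Γ :=
  seq (loop .buf' fun e => seq (pushes k (h e)) (pushes .buf [e]))
    (loop .buf fun e => pushes .buf' [e])

/-- The word lies reversed on `buf'`, so its last letter is popped first and the pushed blocks end
up in order. The copy collected on `buf` is moved back afterwards, because `flush` reads the same
parameter five times. -/
theorem exec_emit (k : Stk) (hk : k ≠ .buf) (hk' : k ≠ .buf') (h : PSym × Bool → List (Stk.Γ k))
    (hh : ∀ e, (h e).length ≤ 3) (s : Store Stk.Γ) (l : List (PSym × Bool)) (hs : s .buf = [])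
    (hs' : s .buf' = l.reverse) :
    Exec (emit k h) s (update s k (l.flatMap h ++ s k)) (7 * l.length + 2) := by
  have h1 := exec_move₂ (Γ := Stk.Γ) hk'.symm (show Stk.buf' ≠ Stk.buf by decide) hk h
    (fun e => [e]) 4 (fun e => Nat.succ_le_succ (hh e)) s
  have h2 := exec_move (Γ := Stk.Γ) (show Stk.buf ≠ Stk.buf' by decide) (fun e => [e]) 1
    (fun _ => le_rfl) (update (update (update s .buf' []) k (l.flatMap h ++ s k)) .buf l)
  have hid : ∀ l : List (PSym × Bool), l.flatMap (fun e => [e]) = l := fun l => by simp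
  rw [hs, hs', List.reverse_reverse, List.append_nil, List.length_reverse, hid] at h1
  rw [update_self, update_of_ne (show Stk.buf' ≠ Stk.buf by decide), update_of_ne hk'.symm,
    update_self, List.append_nil, hid, update_idem] at h2
  have h3 : update (update (update (update s .buf' []) k (l.flatMap h ++ s k)) .buf [])
      .buf' l.reverse = update s k (l.flatMap h ++ s k) := by
    rw [update_comm (show Stk.buf ≠ Stk.buf' by decide), update_comm hk', update_idem,
      ← hs', update_eq_self, ← hs, update_comm hk]
    simp
  rw [h3] at h2
  exact .seq h1 h2 (by omega)

/-- Dealing with a parameter beginning with `e`, the rest of which is on `buf`. -/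
def flush (e : PSym × Bool) : Prog Stk.Γ := seqs [
  push .buf e,
  loop .buf fun e => pushes .buf' [e],
  -- Stacks grow at the front, so the pieces of `corruptPar` and of `flattenPar` are produced last
  -- piece first.
  emit .corr posBits,
  pushes .corr [true, true, false],
  emit .corr nameBits,
  pushes .corr [false, true, false, false, false, true, true, false],
  emit .corr negBits,
  pushes .corr [true, true, false],
  emit .corr nameBits,
  pushes .corr
    [false, true, true, false, true, true, false, true, false, false, false, false, true, false],
  pushes .flat [true, true, false],
  emit .flat nameBits,
  pushes .flat [false, false, false, true, false],
  loop .buf' fun _ => skip]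

theorem length_posBits_le (e : PSym × Bool) : (posBits e).length ≤ 3 := by
  revert e; decide

theorem length_negBits_le (e : PSym × Bool) : (negBits e).length ≤ 3 := by
  revert e; decide

theorem length_nameBits_le (e : PSym × Bool) : (nameBits e).length ≤ 3 := by
  revert e; decide

theorem exec_flush (e : PSym × Bool) (y a : List (PSym × Bool)) (w t : List Bool) :
    Exec (flush e) (sto [] [] [] y a [] w t)
      (sto [] [] [] y [] [] (corruptPar (e :: a) ++ w) (flattenPar (e :: a) ++ t))
      (38 * (a.length + 1) + 49) := by
  have e1 : Exec (push .buf e) (sto [] [] [] y a [] w t) (sto [] [] [] y (e :: a) [] w t) 1 := by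
    have := Exec.push (sto [] [] [] y a [] w t) Stk.buf e 0
    rwa [update_buf] at this
  rw [← List.length_cons (a := e)]
  generalize e :: a = l at *
  have e2 : Exec (loop .buf fun e => pushes .buf' [e]) (sto [] [] [] y l [] w t)
      (sto [] [] [] y [] l.reverse w t) (l.length * 2 + 1) := by
    have := exec_move (Γ := Stk.Γ) (k := Stk.buf) (k' := Stk.buf') (by decide) (fun e => [e]) 1
      (fun _ => le_rfl) (sto [] [] [] y l [] w t)
    rw [update_buf, update_buf'] at this
    simpa [sto] using this
  have pc : ∀ u w t, Exec (pushes .corr u) (sto [] [] [] y [] l.reverse w t)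
      (sto [] [] [] y [] l.reverse (u ++ w) t) u.length := fun u w t => by
    have := exec_pushes (Γ := Stk.Γ) Stk.corr u (sto [] [] [] y [] l.reverse w t)
    rwa [update_corr] at this
  have pf : ∀ u w t, Exec (pushes .flat u) (sto [] [] [] y [] l.reverse w t)
      (sto [] [] [] y [] l.reverse w (u ++ t)) u.length := fun u w t => by
    have := exec_pushes (Γ := Stk.Γ) Stk.flat u (sto [] [] [] y [] l.reverse w t)
    rwa [update_flat] at this
  have ec : ∀ h : PSym × Bool → List Bool, (∀ e, (h e).length ≤ 3) → ∀ w t,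
      Exec (emit .corr h) (sto [] [] [] y [] l.reverse w t)
        (sto [] [] [] y [] l.reverse (l.flatMap h ++ w) t) (7 * l.length + 2) := fun h hh w t => by
    have := exec_emit .corr (by decide) (by decide) h hh (sto [] [] [] y [] l.reverse w t) l rfl rfl
    rwa [update_corr] at this
  have ef : ∀ h : PSym × Bool → List Bool, (∀ e, (h e).length ≤ 3) → ∀ w t,
      Exec (emit .flat h) (sto [] [] [] y [] l.reverse w t)
        (sto [] [] [] y [] l.reverse w (l.flatMap h ++ t)) (7 * l.length + 2) := fun h hh w t => by
    have := exec_emit .flat (by decide) (by decide) h hh (sto [] [] [] y [] l.reverse w t) l rfl rfl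
    rwa [update_flat] at this
  have e3 : ∀ w t, Exec (loop .buf' fun _ => skip) (sto [] [] [] y [] l.reverse w t)
      (sto [] [] [] y [] [] w t) (l.length + 1) := fun w t => by
    have := exec_clear (Γ := Stk.Γ) Stk.buf' (sto [] [] [] y [] l.reverse w t)
    rw [update_buf'] at this
    simpa [sto] using this
  have key : Exec (flush e) _ _ _ := Exec.seq e1 (.seq e2 (.seq (ec _ length_posBits_le _ _) (.seq (pc _ _ _)
    (.seq (ec _ length_nameBits_le _ _) (.seq (pc _ _ _) (.seq (ec _ length_negBits_le _ _)
    (.seq (pc _ _ _) (.seq (ec _ length_nameBits_le _ _) (.seq (pc _ _ _) (.seq (pf _ _ _)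
    (.seq (ef _ length_nameBits_le _ _) (.seq (pf _ _ _) (.seq (e3 _ _) (.skip _ 0) le_rfl)
    le_rfl) le_rfl) le_rfl) le_rfl) le_rfl) le_rfl) le_rfl) le_rfl) le_rfl) le_rfl) le_rfl)
    le_rfl) le_rfl
  simp only [corruptPar, flattenPar, List.append_assoc]
  -- With `n = l.length`: five passes of `7n + 2`, a move of `2n + 1`, a clearing of `n + 1`, one
  -- push and 36 constant bits add up to `38n + 49`.
  refine key.mono ?_
  simp only [List.length_cons, List.length_nil]
  omega

/-- One step of the translation. -/
def translatorStep (e : PSym × Bool) : Prog Stk.Γ :=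
  if e.1 = par then flush e
  else if e.1.inner then push .buf e
  else seq (pushes .corr (corruptBits e)) (pushes .flat (posBits e))

theorem length_corruptBits_le (e : PSym × Bool) : (corruptBits e).length ≤ 11 := by
  revert e; decide

theorem exec_translatorStep (e : PSym × Bool) (y : List (PSym × Bool))
    (x : List (PSym × Bool) × List Bool × List Bool) :
    Exec (translatorStep e) (sto [] [] [] y x.1 [] x.2.1 x.2.2)
      (sto [] [] [] y (translateStep e x).1 [] (translateStep e x).2.1 (translateStep e x).2.2)
      (38 * (x.1.length + 1) + 49) := by
  obtain ⟨a, w, t⟩ := x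
  rw [translatorStep, translateStep]
  split_ifs
  · exact exec_flush e y a w t
  · have := Exec.push (sto [] [] [] y a [] w t) Stk.buf e 0
    rw [update_buf] at this
    exact this.mono (by omega)
  · have h1 := (exec_pushes (Γ := Stk.Γ) Stk.corr (corruptBits e)
      (sto [] [] [] y a [] w t)).mono (length_corruptBits_le e)
    have h2 := (exec_pushes (Γ := Stk.Γ) Stk.flat (posBits e)
      (sto [] [] [] y a [] (corruptBits e ++ w) t)).mono (length_posBits_le e)
    rw [update_corr] at h1
    rw [update_flat] at h2
    exact .seq h1 h2 (by omega)

/-- The program for `reduce`. -/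
def reducer : Prog Stk.Γ := seqs [
  parser false,
  loop .tr translatorStep,
  -- The buffer is in fact empty here; clearing it spares a proof of this.
  loop .buf fun _ => skip,
  loop .corr fun b => pushes .bits [b],
  loop .bits fun b => pushes .flat [b],
  pushes .flat [false, true, true]]

/-- A bound for the running time of `reducer`. -/
noncomputable def reducerTime : Polynomial ℕ :=
  -- The factor 6 multiplies the time of the translation loop, which also bounds the lengths of
  -- `buf` and `corr`: one for the loop, one for clearing `buf`, and two for each of the two moves
  -- of the word on `corr`.
  .C 15 * .X + .C 20 + .C 6 * (.X * (.C 38 * (.X + 1) + .C 50) + 1)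

theorem exec_reducer (x : List Bool) :
    Exec reducer (sto x.reverse [] [] [] [] [] [] []) (sto [] [] [] [] [] [] [] (reduce x))
      (reducerTime.eval x.length) := by
  set N := x.length with hN
  have e2 : Exec (loop .tr translatorStep) (sto [] [] [] (parse false x).reverse [] [] [] [])
      (sto [] [] [] [] (translate (parse false x)).1 [] (translate (parse false x)).2.1
        (translate (parse false x)).2.2) (N * (38 * (N + 1) + 50) + 1) := by
    have := exec_loop (k := Stk.tr) (P := translatorStep)
      (fun (x : List (PSym × Bool) × List Bool × List Bool) y =>
        sto [] [] [] y x.1 [] x.2.1 x.2.2)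
      -- Buffered and unread symbols together never exceed the input length `N`, so every single
      -- step is linear in `N`.
      (fun x e => translateStep e x) (fun x y => x.1.length + y.length ≤ N) (38 * (N + 1) + 49)
      (fun _ _ => rfl) (fun _ _ _ => update_tr ..)
      (fun x e y h => by
        rw [List.length_cons] at h
        rw [translateStep]
        split_ifs <;> simp only [List.length_nil, List.length_cons] <;> omega)
      (fun x e y h => by
        rw [List.length_cons] at h
        exact (exec_translatorStep e y x).mono (by omega))
      ([], [], []) (parse false x).reverse (by simpa using length_parse_le false x)
    -- The trace lies on `tr` with its last symbol on top, so popping realizes the right fold of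
    -- `translate`.
    rw [List.foldl_reverse] at this
    refine this.mono ?_
    rw [List.length_reverse]
    exact Nat.succ_le_succ (Nat.mul_le_mul_right (38 * (N + 1) + 50) (length_parse_le false x))
  have hbuf := e2.length_le Stk.buf
  have hcorr := e2.length_le Stk.corr
  simp only [sto, List.length_nil, zero_add] at hbuf hcorr
  generalize hB : N * (38 * (N + 1) + 50) + 1 = B at *
  rw [reduce]
  generalize translate (parse false x) = z at *
  obtain ⟨a, w, t⟩ := z
  change a.length ≤ B at hbuf
  change w.length ≤ B at hcorr
  have e3 : Exec (loop .buf fun _ => skip) (sto [] [] [] [] a [] w t)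
      (sto [] [] [] [] [] [] w t) (B + 1) := by
    have := exec_clear (Γ := Stk.Γ) Stk.buf (sto [] [] [] [] a [] w t)
    rw [update_buf] at this
    exact this.mono (Nat.succ_le_succ hbuf)
  have e4 : Exec (loop .corr fun b => pushes .bits [b]) (sto [] [] [] [] [] [] w t)
      (sto [] w.reverse [] [] [] [] [] t) (w.length * 2 + 1) := by
    have := exec_move (Γ := Stk.Γ) (k := Stk.corr) (k' := Stk.bits) (by decide) (fun b => [b]) 1
      (fun _ => le_rfl) (sto [] [] [] [] [] [] w t)
    rw [update_corr, update_bits] at this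
    simpa [sto] using this
  have e5 : Exec (loop .bits fun b => pushes .flat [b]) (sto [] w.reverse [] [] [] [] [] t)
      (sto [] [] [] [] [] [] [] (w ++ t)) (w.length * 2 + 1) := by
    have := exec_move (Γ := Stk.Γ) (k := Stk.bits) (k' := Stk.flat) (by decide) (fun b => [b]) 1
      (fun _ => le_rfl) (sto [] w.reverse [] [] [] [] [] t)
    rw [update_bits, update_flat] at this
    simpa [sto] using this
  have e6 := exec_pushes (Γ := Stk.Γ) Stk.flat [false, true, true]
    (sto [] [] [] [] [] [] [] (w ++ t))
  rw [update_flat] at e6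
  refine (Exec.seq (exec_parser false x) (.seq e2 (.seq e3 (.seq e4 (.seq e5 (.seq e6 (.skip _ 0)
    le_rfl) le_rfl) le_rfl) le_rfl) le_rfl) le_rfl).mono ?_
  simp only [reducerTime, Polynomial.eval_add, Polynomial.eval_mul, Polynomial.eval_C,
    Polynomial.eval_X, Polynomial.eval_one, hB, List.length_cons, List.length_nil]
  omega

end Prog

/-! ### Reducibility in both directions and the theorem -/

open PSym Prog

/-- Composition with a function computed by a stack program. -/
theorem PolyTimeReducible.trans_prog {A B B' : Language Bool} (h : PolyTimeReducible A B)
    (g : List Bool → List Bool) (P : Prog Stk.Γ) (p : Polynomial ℕ)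
    (hP : ∀ x, Exec P (sto x.reverse [] [] [] [] [] [] []) (sto [] [] [] [] [] [] [] (g x))
      (p.eval x.length)) (hg : ∀ x, x ∈ B ↔ g x ∈ B') : PolyTimeReducible A B' := by
  obtain ⟨f, ⟨hf⟩, hAB⟩ := h
  refine ⟨g ∘ f, Turing.FinTM2.computableInPolyTime_comp hf P .inp .flat (Equiv.refl Bool)
    (Equiv.refl Bool) p fun x => ?_, fun x => (hAB x).trans (hg _)⟩
  have := hP x
  rw [← sto_nil, update_inp, update_flat]
  simpa using this

theorem PolyTimeReducible.refl (A : Language Bool) : PolyTimeReducible A A :=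
  ⟨id, ⟨Turing.idComputableInPolyTime _⟩, fun _ => Iff.rfl⟩

/-- Composition with an arbitrary reduction to `valMinc s` gives hardness; applied to the identity
reduction, it is the reduction itself, which gives membership. The same holds for `trans_reduce`. -/
theorem PolyTimeReducible.trans_restrict {s : TeamSemantics} {A : Language Bool}
    (h : PolyTimeReducible A (valMinc.{u} s)) : PolyTimeReducible A (valEMinc.{u} s) :=
  h.trans_prog restrict restricter (.C 17 * .X + .C 10)
    (fun x => by simpa using exec_restricter x) (mem_valMinc_iff s)

theorem PolyTimeReducible.trans_reduce {s : TeamSemantics} {A : Language Bool}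
    (h : PolyTimeReducible A (valEMinc.{u} s)) : PolyTimeReducible A (valMinc.{u} s) :=
  h.trans_prog reduce reducer reducerTime exec_reducer (mem_valEMinc_iff s)

theorem theorema (s : TeamSemantics) (C : Set (Language Bool))
    (hC : ClosedUnderPolyTimeReductions C) :
    IsCompleteFor (valMinc.{u} s) C ↔ IsCompleteFor (valEMinc.{u} s) C :=
  ⟨fun h => ⟨hC _ _ (PolyTimeReducible.refl _).trans_reduce h.1,
      fun B hB => (h.2 B hB).trans_restrict⟩,
    fun h => ⟨hC _ _ (PolyTimeReducible.refl _).trans_restrict h.1,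
      fun B hB => (h.2 B hB).trans_reduce⟩⟩
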